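/- Let $T$ be a compact metric space, let $\mathbb C(T)$ be the space of continuous real functions on $T$ with the uniform norm $\|\cdot\|$, let $\mathbb C^+\subset \mathbb C(T)$ be the cone of nonnegative functions, $\mathbb C_0^+=\mathbb C^+\setminus\{0\}$ and $S=\{x\in\mathbb C^+:\|x\|=1\}$. Let $\overline{\mathbb C}_0^+=(0,+\infty]\times S$ with the metric $$d\big((r_1,s_1),(r_2,s_2)\big)=|1/r_1-1/r_2|+\|s_1-s_2\|\qquad(1/\infty=0),$$ and identify $\mathbb C_0^+$ with $(0,+\infty)\times S\subset\overline{\mathbb C}_0^+$ by $x\mapsto(\|x\|,x/\|x\|)$. A Borel measure on a metric space is boundedly finite if it is finite on bounded Borel sets; boundedly finite measures $\mu_n$ converge $\sharp$-weakly to a boundedly finite measure $\mu$, written $\mu_n\xrightarrow{w^\sharp}\mu$, if $\int f\,d\mu_n\to\int f\,d\mu$ for every bounded continuous real function $f$ with bounded support. For each $n\ge1$ let $X_n$ be a random element of $\mathbb C^+$ and let $X_{in}$, $i\ge1$, be independent copies of $X_n$. Put $M_n(t)=\max_{1\le i\le n}X_{in}(t)$, $t\in T$. Let $\nu$ be a boundedly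 finite Borel measure on $\overline{\mathbb C}_0^+$ such that $$n\,\mathbb P[X_n\in\cdot\,]\xrightarrow{w^\sharp}\nu\ \text{ on }\overline{\mathbb C}_0^+\qquad\text{and}\qquad \nu(\overline{\mathbb C}_0^+\setminus\mathbb C_0^+)=0,$$ where $\mathbb P[X_n\in\cdot\,]$ is restricted to $\mathbb C_0^+$ (the possible mass at the zero function is dropped). **Theorem.** Poisson point processes $\sum_{i}\delta_{Y_i}$ on $\mathbb C_0^+$ with intensity $\nu$ exist (as random boundedly finite point measures on $\overline{\mathbb C}_0^+$ with a finite or countably infinite, random number of points $Y_i$, all in $\mathbb C_0^+$). For every such process, the function $$M(t)=\sup_i Y_i(t),\qquad t\in T$$ (with $\sup\emptyset=0$) is finite and continuous on $T$, $M$ is a random element of $\mathbb C(T)$, and $M_n$ converges weakly to $M$ in $\mathbb C(T)$ as $n\to\infty$. -/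

import Mathlib

open MeasureTheory ProbabilityTheory Filter Topology Set
open scoped ENNReal NNReal BoundedContinuousFunction

universe u v w w₀

noncomputable section

/-! ### Boundedly finite measures, `♯`-weak convergence, Poisson point processes -/

section PointProcesses

variable {E : Type*} [MeasurableSpace E]

/-- A measure is boundedly finite if bounded Borel sets have finite measure. -/
def IsBoundedlyFinite [PseudoMetricSpace E] (μ : Measure E) : Prop :=
  ∀ B : Set E, MeasurableSet B → Bornology.IsBounded B → μ B < ∞

/-- `♯`-weak convergence of boundedly finite measures: convergence of the integrals of all bounded
continuous real functions with bounded support. -/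
structure SharpTendsto [PseudoMetricSpace E] (μ : ℕ → Measure E) (μlim : Measure E) : Prop where
  boundedlyFinite : ∀ n, IsBoundedlyFinite (μ n)
  boundedlyFinite_lim : IsBoundedlyFinite μlim
  tendsto_integral : ∀ f : E →ᵇ ℝ, Bornology.IsBounded (Function.support f) →
    Tendsto (fun n => ∫ x, f x ∂(μ n)) atTop (𝓝 (∫ x, f x ∂μlim))

/-- The measure `∑_{i ∈ I} δ_{x i}`. -/
def pointMeasure {I : Set ℕ} (x : I → E) : Measure E :=
  Measure.sum fun i => Measure.dirac (x i)

/-- Boundedly finite point measures: `μ = ∑_{i ∈ I} δ_{x i}` for a finite or countable family of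
points, of which only finitely many lie in any given bounded set. -/
def IsBoundedlyFinitePointMeasure [PseudoMetricSpace E] (μ : Measure E) : Prop :=
  ∃ (I : Set ℕ) (x : I → E),
    (∀ B : Set E, Bornology.IsBounded B → {i | x i ∈ B}.Finite) ∧ μ = pointMeasure x

/-- `N` is a Poisson point process with intensity `ν` on the probability space `(Ω, P)`: a
measurable map into the boundedly finite point measures such that the number of points in a bounded
Borel set `B` has the Poisson distribution of parameter `ν B` and the numbers of points in pairwise
disjoint bounded Borel sets are independent. -/
structure IsPoissonPointProcess [PseudoMetricSpace E] {Ω : Type*} [MeasurableSpace Ω]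
    (N : Ω → Measure E) (ν : Measure E) (P : Measure Ω) : Prop where
  measurable : Measurable N
  pointMeasure : ∀ ω, IsBoundedlyFinitePointMeasure (N ω)
  map_apply : ∀ B : Set E, MeasurableSet B → Bornology.IsBounded B →
    P.map (fun ω => N ω B) = (poissonMeasure (ν B).toNNReal).map (fun k : ℕ => (k : ℝ≥0∞))
  indep : ∀ (m : ℕ) (B : Fin m → Set E), (∀ j, MeasurableSet (B j)) →
    (∀ j, Bornology.IsBounded (B j)) → Pairwise (fun j k => Disjoint (B j) (B k)) →
    iIndepFun (fun j ω => N ω (B j)) P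

end PointProcesses

/-! ### The spaces of continuous functions -/

section Spaces

variable (T : Type*) [MetricSpace T] [CompactSpace T]

/-- `C(T)`, with the topology of uniform convergence, carries its Borel `σ`-algebra. -/
instance instMeasurableSpaceCont : MeasurableSpace C(T, ℝ) := borel _

instance instBorelSpaceCont : BorelSpace C(T, ℝ) := ⟨rfl⟩

/-- The space `C₀⁺ = C⁺ \ {0}` of nonzero nonnegative continuous functions on `T`. -/
abbrev CZeroPlus : Type _ := {x : C(T, ℝ) // 0 ≤ x ∧ x ≠ 0}

/-- The space `(0, +∞] × S`, where `S` is the unit sphere of the cone of nonnegative continuous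
functions on `T` for the uniform norm. -/
@[ext]
structure CBarZeroPlus where
  radius : ℝ≥0∞
  angle : C(T, ℝ)
  radius_pos : 0 < radius
  angle_nonneg : 0 ≤ angle
  norm_angle : ‖angle‖ = 1

variable {T}

/-- The metric `d((r₁, s₁), (r₂, s₂)) = |1/r₁ - 1/r₂| + ‖s₁ - s₂‖`, where `1/∞ = 0`. -/
instance instMetricSpaceCBar : MetricSpace (CBarZeroPlus T) where
  dist p q := |(p.radius⁻¹).toReal - (q.radius⁻¹).toReal| + ‖p.angle - q.angle‖
  dist_self p := by simp
  dist_comm p q := by rw [abs_sub_comm, norm_sub_rev]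
  dist_triangle p q r := by
    have h₁ := abs_sub_le (p.radius⁻¹).toReal (q.radius⁻¹).toReal (r.radius⁻¹).toReal
    have h₂ := norm_sub_le_norm_sub_add_norm_sub p.angle q.angle r.angle
    linarith
  eq_of_dist_eq_zero {p q} h := by
    have h₁ := abs_nonneg ((p.radius⁻¹).toReal - (q.radius⁻¹).toReal)
    have h₂ := norm_nonneg (p.angle - q.angle)
    have h₃ : (p.radius⁻¹).toReal - (q.radius⁻¹).toReal = 0 := abs_eq_zero.mp (by linarith)
    have h₄ : p.angle - q.angle = 0 := norm_eq_zero.mp (by linarith)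
    refine CBarZeroPlus.ext ?_ (sub_eq_zero.mp h₄)
    have h₅ := (ENNReal.toReal_eq_toReal_iff' (ENNReal.inv_ne_top.mpr p.radius_pos.ne')
      (ENNReal.inv_ne_top.mpr q.radius_pos.ne')).mp (sub_eq_zero.mp h₃)
    exact inv_injective h₅

instance instMeasurableSpaceCBar : MeasurableSpace (CBarZeroPlus T) := borel _

instance instBorelSpaceCBar : BorelSpace (CBarZeroPlus T) := ⟨rfl⟩

/-- The polar decomposition `x ↦ (‖x‖, x / ‖x‖)`, by which `C₀⁺` is identified with the part
`(0, ∞) × S` of `(0, ∞] × S`. -/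
def polar (x : CZeroPlus T) : CBarZeroPlus T where
  radius := ENNReal.ofReal ‖x.1‖
  angle := ‖x.1‖⁻¹ • x.1
  radius_pos := ENNReal.ofReal_pos.mpr (norm_pos_iff.mpr x.2.2)
  angle_nonneg := smul_nonneg (inv_nonneg.mpr (norm_nonneg _)) x.2.1
  norm_angle := by
    rw [norm_smul, norm_inv, norm_norm, inv_mul_cancel₀ (norm_ne_zero_iff.mpr x.2.2)]

/-- The measure `P[X ∈ ·]` on `(0, ∞] × S`: the law of the nonnegative random function `X`,
restricted to `C₀⁺` and seen there through the polar decomposition. A mass at the zero function is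
dropped, since that function is not a point of this space. -/
def polarLaw {Ω : Type*} [MeasurableSpace Ω] (X : Ω → C(T, ℝ)) (P : Measure Ω) :
    Measure (CBarZeroPlus T) :=
  ((P.map X).comap (Subtype.val : CZeroPlus T → C(T, ℝ))).map polar

/-- The pointwise maximum of the nonnegative functions `x 0, …, x (n - 1)`, equal to `0` if
`n = 0`. -/
def maxFun (x : ℕ → C(T, ℝ)) (n : ℕ) : C(T, ℝ) :=
  (Finset.range n).fold (· ⊔ ·) 0 x

end Spaces

end

set_option linter.unusedSectionVars false

/-! The maximum of independent elements of a semilattice is treated as a random walk. For a law `Q`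
on the cone put `(A f)(x) = ∫ f (x ⊔ y) dQ(y)` (`supAverage`). The mean of `f` at the maximum of `n`
independent copies is `(A ^ n f)(⊥)` (`integral_sup_range_eq`), and for a Poisson number of copies
with parameter `c` it is `(e^{c (A - 1)} f)(⊥)`. With `G n = n (A n - 1)` the core of the theorem is
therefore `(1 + G n / n) ^ n → e ^ G`. If `n` times the mass of `Q n` off `⊥` is at most `C`, then
`G n` has norm at most `2 C` and multiplies Lipschitz constants by at most `2 C`. This
equicontinuity upgrades convergence of integrals of fixed increments to varying ones, so `G n ^ k f
→ G ^ k f` pointwise by induction on `k`, and dominated convergence in the binomial series concludes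
(`tendsto_supAverage_pow`). No tightness argument is needed.

The hypothesis controls only test functions supported away from the zero function. Hence norms are
capped at `1 / δ` and lowered by `δ`. This truncation extends continuously to infinite radius and
kills norms up to `δ`, so that increments of functions of it are admissible test functions. It moves
a function of norm at most `1 / δ` by at most `δ`, and maxima do not amplify this error. Larger
norms cost a multiple of `n` times the mean of a cut-off near infinite radius; its limit vanishes as
`δ → 0` because `ν` does not charge infinite radius (`abs_integral_sub_truncFun_le`,
`tendsto_integral_cutoffBCF_zero`).

On the Poisson side, only finitely many points survive truncation. The law of their maximum is
determined by the probabilities of lying below finitely many levels, which are void probabilities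
`e^{-ν W}`; it is thus the law of a compound Poisson maximum (`IsPoissonPointProcess.map_pointSup`).
As `δ → 0` these maxima converge uniformly to the supremum of all points, which yields its
continuity and measurability (`exists_isLUB_continuousMap`). Existence of the process comes from
independent Poisson samples in bounded shells, identified through characteristic functions. -/

/-! ### Exponential and binomial series of operators. -/

/-- `e^{c (A - 1)} = e^{-c} e^{c A}`, tested against a vector and a functional. -/
lemma tsum_exp_smul_sub_one {F : Type*} [NormedAddCommGroup F] [NormedSpace ℝ F] [CompleteSpace F]
    (c : ℝ) (A : F →L[ℝ] F) (l : F →L[ℝ] ℝ) (f : F) :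
    ∑' k : ℕ, (k.factorial : ℝ)⁻¹ * l (((c • (A - 1)) ^ k) f) =
      ∑' k : ℕ, Real.exp (-c) * c ^ k / k.factorial * l ((A ^ k) f) := by
  let ev : (F →L[ℝ] F) →L[ℝ] ℝ := l.comp (ContinuousLinearMap.apply ℝ F f)
  have hexp : ∀ B : F →L[ℝ] F,
      ∑' k : ℕ, (k.factorial : ℝ)⁻¹ * l ((B ^ k) f) = ev (NormedSpace.exp B) := fun B => by
    have := ev.hasSum (NormedSpace.exp_series_hasSum_exp' (𝕂 := ℝ) B)
    rw [← this.tsum_eq]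
    simp [ev]
  have hsplit : NormedSpace.exp (c • (A - 1)) = Real.exp (-c) • NormedSpace.exp (c • A) := by
    have hA : c • (A - 1) = algebraMap ℝ _ (-c) + c • A := by
      rw [Algebra.algebraMap_eq_smul_one]
      module
    let : NormedAlgebra ℚ (F →L[ℝ] F) := NormedAlgebra.restrictScalars ℚ ℝ _
    rw [hA, NormedSpace.exp_add_of_commute (Algebra.commutes _ _),
      ← NormedSpace.algebraMap_exp_comm, ← Algebra.smul_def, Real.exp_eq_exp_ℝ]
  rw [hexp, hsplit, map_smul, ← hexp, smul_eq_mul, ← tsum_mul_left]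
  congr 1; ext k
  rw [smul_pow, _root_.smul_apply, map_smul, smul_eq_mul]
  ring

/-- Binomial expansion of `A ^ n` around the identity, tested against a vector and a functional. -/
lemma pow_apply_eq_tsum_smul_sub_one {F : Type*} [NormedAddCommGroup F] [NormedSpace ℝ F]
    {n : ℕ} (hn : 1 ≤ n) (A : F →L[ℝ] F) (l : F →L[ℝ] ℝ) (f : F) :
    l ((A ^ n) f) =
      ∑' k : ℕ, (n.choose k * (1 / n : ℝ) ^ k) * l ((((n : ℝ) • (A - 1)) ^ k) f) := by
  have hn0 : (n : ℝ) ≠ 0 := by positivity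
  have hA : A = (1 / n : ℝ) • ((n : ℝ) • (A - 1)) + 1 := by
    rw [smul_smul, one_div, inv_mul_cancel₀ hn0, one_smul, sub_add_cancel]
  have hk : ∀ (B : F →L[ℝ] F) (k : ℕ),
      l ((((1 / n : ℝ) • B) ^ k * 1 ^ (n - k) * (n.choose k : F →L[ℝ] F)) f) =
        (n.choose k * (1 / n : ℝ) ^ k) * l ((B ^ k) f) := by
    intro B k
    rw [one_pow, mul_one, smul_pow, ← Nat.cast_commute, ← nsmul_eq_mul, _root_.smul_apply,
      _root_.smul_apply, map_nsmul, map_smul, nsmul_eq_mul, smul_eq_mul, mul_assoc]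
  conv_lhs => rw [hA, (Commute.one_right _).add_pow, _root_.sum_apply, map_sum]
  -- The terms with `k > n` vanish; the infinite series allows dominated convergence as `n → ∞`.
  rw [tsum_eq_sum (s := Finset.range (n + 1)) (fun k hk => by
    rw [Nat.choose_eq_zero_of_lt (by simpa using hk)]; simp)]
  exact Finset.sum_congr rfl fun k _ => hk _ k


/-! ### Averaging operators on a semilattice and the Poisson limit for maxima. -/

section SupOperator

variable {Y : Type*} [MetricSpace Y] [SemilatticeSup Y] [MeasurableSpace Y] [BorelSpace Y]

lemma integrable_comp_sup [ContinuousSup Y] (μ : Measure Y) [IsFiniteMeasure μ] (f : Y →ᵇ ℝ) (x : Y) :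
    Integrable (fun y => f (x ⊔ y)) μ :=
  (f.compContinuous ⟨fun y => x ⊔ y, by fun_prop⟩).integrable μ

variable [OrderBot Y]

/-- Only the mass off `⊥` contributes. For `c = n` this is what makes all later bounds uniform in
`n`. -/
lemma abs_mul_integral_le_of_support {c K C : ℝ} (hc : 0 ≤ c) (hK : 0 ≤ K) (μ : Measure Y)
    [IsProbabilityMeasure μ]
    (hC : c * μ.real {y | y ≠ ⊥} ≤ C) (g : Y → ℝ) (hg : ∀ y, |g y| ≤ K) (hg0 : g ⊥ = 0) :
    |c * ∫ y, g y ∂μ| ≤ K * C := by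
  have hm : MeasurableSet {y : Y | y ≠ ⊥} := (measurableSet_singleton _).compl
  have h1 : |∫ y, g y ∂μ| ≤ ∫ y, {y : Y | y ≠ ⊥}.indicator (fun _ => K) y ∂μ := by
    rw [← Real.norm_eq_abs]
    refine norm_integral_le_of_norm_le ((integrable_const K).indicator hm) (ae_of_all _ fun y => ?_)
    by_cases hy : y = ⊥
    · simp [hy, hg0]
    · simpa [hy] using hg y
  rw [integral_indicator_const _ hm, smul_eq_mul] at h1
  rw [abs_mul, abs_of_nonneg hc]
  calc c * |∫ y, g y ∂μ| ≤ c * (μ.real {y | y ≠ ⊥} * K) := by gcongr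
    _ = K * (c * μ.real {y | y ≠ ⊥}) := by ring
    _ ≤ K * C := by gcongr

variable [ContinuousSup Y]

/-- The operator `f ↦ (x ↦ ∫ f (x ⊔ y) dμ(y))` on bounded continuous functions. -/
noncomputable def supAverage (μ : Measure Y) [IsProbabilityMeasure μ] :
    (Y →ᵇ ℝ) →L[ℝ] (Y →ᵇ ℝ) :=
  LinearMap.mkContinuous
    { toFun := fun f => BoundedContinuousFunction.ofNormedAddCommGroup
        (fun x => ∫ y, f (x ⊔ y) ∂μ)
        (continuous_of_dominated (bound := fun _ => ‖f‖)
          (fun x => (integrable_comp_sup μ f x).aestronglyMeasurable)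
          (fun x => ae_of_all _ fun y => f.norm_coe_le_norm _) (integrable_const _)
          (ae_of_all _ fun y => by fun_prop))
        ‖f‖ (fun x => (norm_integral_le_of_norm_le_const
          (ae_of_all _ fun y => f.norm_coe_le_norm _)).trans (by simp))
      map_add' := fun f g => by
        ext x
        exact integral_add (integrable_comp_sup μ f x) (integrable_comp_sup μ g x)
      map_smul' := fun c f => by
        ext x
        exact integral_const_mul c _ }
    1 (fun f => by
      rw [one_mul]
      exact (BoundedContinuousFunction.norm_le (norm_nonneg _)).2 fun x =>
        (norm_integral_le_of_norm_le_const
          (ae_of_all _ fun y => f.norm_coe_le_norm _)).trans (by simp))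

lemma supAverage_apply (μ : Measure Y) [IsProbabilityMeasure μ] (f : Y →ᵇ ℝ) (x : Y) :
    supAverage μ f x = ∫ y, f (x ⊔ y) ∂μ := rfl

/-- The multiple `c (A - 1)` of the generator of a compound Poisson maximum. -/
noncomputable def supGenerator (c : ℝ) (μ : Measure Y) [IsProbabilityMeasure μ] :
    (Y →ᵇ ℝ) →L[ℝ] (Y →ᵇ ℝ) :=
  c • (supAverage μ - 1)

/-- Writing `x` as `x ⊔ ⊥` makes the integrand an increment `h y - h ⊥` of `h = f (x ⊔ ·)`, the form
in which convergence is assumed. -/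
lemma supGenerator_apply (c : ℝ) (μ : Measure Y) [IsProbabilityMeasure μ] (f : Y →ᵇ ℝ) (x : Y) :
    supGenerator c μ f x = c * ∫ y, (f (x ⊔ y) - f (x ⊔ ⊥)) ∂μ := by
  rw [integral_sub (integrable_comp_sup μ f x) (integrable_const _)]
  simp [supGenerator, supAverage_apply]

lemma norm_supGenerator_apply_le {c C : ℝ} (hc : 0 ≤ c) (μ : Measure Y) [IsProbabilityMeasure μ]
    (hC : c * μ.real {y | y ≠ ⊥} ≤ C) (f : Y →ᵇ ℝ) :
    ‖supGenerator c μ f‖ ≤ 2 * C * ‖f‖ := by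
  have hC0 : 0 ≤ C := le_trans (by positivity) hC
  refine (BoundedContinuousFunction.norm_le (by positivity)).2 fun x => ?_
  rw [supGenerator_apply, Real.norm_eq_abs]
  refine (abs_mul_integral_le_of_support hc (K := 2 * ‖f‖) (by positivity) μ hC _ (fun y => ?_)
    (by simp)).trans (by linarith)
  exact (abs_sub _ _).trans (by
    linarith [f.norm_coe_le_norm (x ⊔ y), f.norm_coe_le_norm (x ⊔ ⊥), Real.norm_eq_abs (f (x ⊔ y)),
      Real.norm_eq_abs (f (x ⊔ ⊥))])

/-- Joining with a fixed element does not increase distances, so both terms of the increment stay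
`L`-Lipschitz in `x`; the two terms give the factor `2`. -/
lemma supGenerator_lipschitz (hY : ∀ x y z : Y, dist (x ⊔ z) (y ⊔ z) ≤ dist x y)
    {c C : ℝ} (hc : 0 ≤ c) (μ : Measure Y) [IsProbabilityMeasure μ]
    (hC : c * μ.real {y | y ≠ ⊥} ≤ C) (f : Y →ᵇ ℝ) {L : ℝ} (hL : 0 ≤ L)
    (hf : ∀ x y, |f x - f y| ≤ L * dist x y) (x y : Y) :
    |supGenerator c μ f x - supGenerator c μ f y| ≤ 2 * C * L * dist x y := by
  have hi : ∀ x, Integrable (fun z => f (x ⊔ z) - f (x ⊔ ⊥)) μ := fun x =>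
    (integrable_comp_sup μ f x).sub (integrable_const _)
  rw [supGenerator_apply, supGenerator_apply, ← mul_sub, ← integral_sub (hi x) (hi y)]
  refine (abs_mul_integral_le_of_support hc (K := 2 * (L * dist x y)) (by positivity) μ hC _
    (fun z => ?_) (by simp)).trans (by linarith)
  have h1 := (hf (x ⊔ z) (y ⊔ z)).trans (mul_le_mul_of_nonneg_left (hY x y z) hL)
  have h2 := (hf (x ⊔ ⊥) (y ⊔ ⊥)).trans (mul_le_mul_of_nonneg_left (hY x y ⊥) hL)
  rw [abs_le] at *
  constructor <;> linarith

lemma exp_supGenerator_apply {c : ℝ} (μ : Measure Y) [IsProbabilityMeasure μ]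
    (f : Y →ᵇ ℝ) (x : Y) :
    ∑' k : ℕ, (k.factorial : ℝ)⁻¹ * (supGenerator c μ ^ k) f x =
      ∑' k : ℕ, Real.exp (-c) * c ^ k / k.factorial * (supAverage μ ^ k) f x :=
  tsum_exp_smul_sub_one c (supAverage μ) (BoundedContinuousFunction.evalCLM ℝ x) f

/-- The increments of `D` are controlled by the values at finitely many points and the distance to them. -/
lemma exists_net_bound [SecondCountableTopology Y] {K L : ℝ} (hK : 0 ≤ K) (hL : 0 ≤ L) :
    ∃ (u : ℕ → Finset Y) (q : ℕ → Y →ᵇ ℝ), (∀ J, q J ⊥ = 0) ∧ (∀ J y, |q J y| ≤ K) ∧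
      (∀ y, Tendsto (fun J => q J y) atTop (𝓝 0)) ∧
      ∀ J (D : Y → ℝ), (∀ y, |D y| ≤ K) → (∀ x y, |D x - D y| ≤ L * dist x y) →
        ∀ y, |D y - D ⊥| ≤ q J y + 2 * ∑ z ∈ u J, |D z| := by
  classical
  let d : ℕ → Y := TopologicalSpace.denseSeq Y
  -- Including `⊥` makes `q J` vanish there, keeps the net nonempty and lets the sum control `D ⊥`
  -- as well.
  let u : ℕ → Finset Y := fun J => insert ⊥ ((Finset.range J).image d)
  have hne : ∀ J, (u J : Set Y).Nonempty := fun J => ⟨⊥, by simp [u]⟩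
  let q : ℕ → Y →ᵇ ℝ := fun J => BoundedContinuousFunction.ofNormedAddCommGroup
    (fun y => min K (L * Metric.infDist y (u J)))
    (continuous_const.min (continuous_const.mul (Metric.continuous_infDist_pt _))) K (fun y => by
      have : 0 ≤ L * Metric.infDist y (u J) := mul_nonneg hL Metric.infDist_nonneg
      rw [Real.norm_eq_abs, abs_of_nonneg (le_min hK this)]
      exact min_le_left _ _)
  have hq : ∀ J y, q J y = min K (L * Metric.infDist y (u J)) := fun _ _ => rfl
  have hq0 : ∀ J y, 0 ≤ q J y := fun J y =>
    le_min hK (mul_nonneg hL Metric.infDist_nonneg)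
  refine ⟨u, q, fun J => ?_, fun J y => ?_, fun y => ?_, fun J D hD hDL y => ?_⟩
  · rw [hq, Metric.infDist_zero_of_mem (by simp [u])]
    simpa using hK
  · rw [abs_of_nonneg (hq0 J y)]
    exact min_le_left _ _
  · rw [Metric.tendsto_atTop]
    intro ε hε
    obtain ⟨j, hj⟩ := (TopologicalSpace.denseRange_denseSeq Y).exists_dist_lt y
      -- `L + 1` instead of `L`, since `L = 0` is allowed.
      (show 0 < ε / (L + 1) by positivity)
    refine ⟨j + 1, fun J hJ => ?_⟩
    rw [Real.dist_0_eq_abs, abs_of_nonneg (hq0 J y), hq]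
    refine (min_le_right _ _).trans_lt ?_
    have hmem : d j ∈ (u J : Set Y) := by
      simp only [u, Finset.coe_insert, Finset.coe_image]
      exact Or.inr ⟨j, by simpa using hJ, rfl⟩
    calc L * Metric.infDist y (u J) ≤ L * dist y (d j) := by
          gcongr; exact Metric.infDist_le_dist_of_mem hmem
      _ ≤ L * (ε / (L + 1)) := by gcongr
      _ < (L + 1) * (ε / (L + 1)) := by gcongr; linarith
      _ = ε := by field_simp
  · have hsum : ∀ z ∈ u J, |D z| ≤ ∑ z ∈ u J, |D z| := fun z hz =>
      Finset.single_le_sum (f := fun z => |D z|) (fun _ _ => abs_nonneg _) hz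
    have h0 := hsum ⊥ (by simp [u])
    obtain ⟨z, hz, hzd⟩ := (u J).finite_toSet.isCompact.exists_infDist_eq_dist (hne J) y
    have hz' := hsum z hz
    have hyz := hDL y z
    rw [← hzd] at hyz
    have hy : |D y| ≤ q J y + ∑ z ∈ u J, |D z| := by
      rw [hq, min_add]
      refine le_min ?_ ?_
      · exact (hD y).trans (le_add_of_nonneg_right ((abs_nonneg _).trans h0))
      · have := abs_sub_abs_le_abs_sub (D y) (D z)
        linarith
    linarith [abs_sub (D y) (D ⊥)]

/-- Convergence of the integrals of increments of a single function extends to equi-Lipschitz,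
uniformly bounded, pointwise convergent sequences. -/
lemma tendsto_mul_integral_increment [SecondCountableTopology Y] {P : ℕ → Measure Y}
    [∀ n, IsProbabilityMeasure (P n)] {Q : Measure Y} [IsProbabilityMeasure Q] {c C : ℝ}
    (hC : ∀ n : ℕ, n * (P n).real {y | y ≠ ⊥} ≤ C)
    (hconv : ∀ h : Y →ᵇ ℝ, Tendsto (fun n : ℕ => (n : ℝ) * ∫ y, (h y - h ⊥) ∂P n) atTop
      (𝓝 (c * ∫ y, (h y - h ⊥) ∂Q)))
    {h : ℕ → Y →ᵇ ℝ} {g : Y →ᵇ ℝ} {K L : ℝ} (hK : 0 ≤ K) (hL : 0 ≤ L)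
    (hb : ∀ n y, |h n y| ≤ K) (hgb : ∀ y, |g y| ≤ K)
    (hlip : ∀ n x y, |h n x - h n y| ≤ L * dist x y) (hglip : ∀ x y, |g x - g y| ≤ L * dist x y)
    (hlim : ∀ y, Tendsto (fun n => h n y) atTop (𝓝 (g y))) :
    Tendsto (fun n : ℕ => (n : ℝ) * ∫ y, (h n y - h n ⊥) ∂P n) atTop
      (𝓝 (c * ∫ y, (g y - g ⊥) ∂Q)) := by
  have hint : ∀ (μ : Measure Y) [IsProbabilityMeasure μ] (k : Y →ᵇ ℝ),
      Integrable (fun y => k y - k ⊥) μ := fun μ _ k => (k.integrable μ).sub (integrable_const _)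
  have hC0 : 0 ≤ C := by simpa using hC 0
  -- Convergence for the fixed function `g` is the hypothesis; what remains is the varying
  -- difference `h n - g`, which tends to `0` pointwise.
  suffices hD : Tendsto (fun n : ℕ => (n : ℝ) * ∫ y, ((h n - g) y - (h n - g) ⊥) ∂P n) atTop
      (𝓝 0) by
    have := hD.add (hconv g)
    rw [zero_add] at this
    refine this.congr fun n => ?_
    rw [← mul_add, ← integral_add (hint _ _) (hint _ _)]
    congr 2; ext y
    simp only [BoundedContinuousFunction.sub_apply]
    ring
  obtain ⟨u, q, hq0, hqK, hqlim, hu⟩ := exists_net_bound (Y := Y) (K := 2 * K) (L := 2 * L)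
    (by positivity) (by positivity)
  have hQ : Tendsto (fun J => c * ∫ y, (q J y - q J ⊥) ∂Q) atTop (𝓝 0) := by
    have : Tendsto (fun J => ∫ y, (q J y - q J ⊥) ∂Q) atTop (𝓝 (∫ y, (0 : ℝ) ∂Q)) := by
      refine tendsto_integral_of_dominated_convergence (fun _ => 2 * K)
        (fun J => (hint _ _).aestronglyMeasurable) (integrable_const _)
        (fun J => ae_of_all _ fun y => ?_) (ae_of_all _ fun y => ?_)
      · simpa [hq0] using hqK J y
      · simpa [hq0] using hqlim y
    simpa using this.const_mul c
  rw [Metric.tendsto_atTop]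
  intro ε hε
  -- The net is fixed first, making the limiting distance term small; then `n → ∞` kills the
  -- finitely many values of `h n - g` on it.
  obtain ⟨J, hJ⟩ := ((hQ.eventually (gt_mem_nhds (show (0 : ℝ) < ε / 2 by positivity)))).exists
  have hlim2 : Tendsto (fun n : ℕ => (n : ℝ) * ∫ y, (q J y - q J ⊥) ∂P n +
      2 * (∑ z ∈ u J, |(h n - g) z|) * C) atTop
      (𝓝 (c * ∫ y, (q J y - q J ⊥) ∂Q + 2 * (∑ z ∈ u J, 0) * C)) := by
    refine (hconv (q J)).add (Tendsto.mul_const _ (Tendsto.const_mul _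
      (tendsto_finsetSum _ fun z _ => ?_)))
    simpa using ((hlim z).sub_const (g z)).abs
  rw [Finset.sum_const_zero, mul_zero, zero_mul, add_zero] at hlim2
  obtain ⟨N, hN⟩ := eventually_atTop.1 (hlim2.eventually (gt_mem_nhds (hJ.trans (half_lt_self hε))))
  refine ⟨N, fun n hn => ?_⟩
  rw [Real.dist_0_eq_abs]
  refine lt_of_le_of_lt ?_ (hN n hn)
  set D := h n - g with hDdef
  set s := ∑ z ∈ u J, |D z|
  have hm : MeasurableSet {y : Y | y ≠ ⊥} := (measurableSet_singleton _).compl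
  have hs : 0 ≤ s := Finset.sum_nonneg fun _ _ => abs_nonneg _
  have hpt : ∀ y, |D y - D ⊥| ≤ (q J y - q J ⊥) + {y : Y | y ≠ ⊥}.indicator (fun _ => 2 * s) y := by
    intro y
    by_cases hy : y = ⊥
    · simp [hy]
    · have := hu J D (fun y => (abs_sub _ _).trans (by linarith [hb n y, hgb y]))
        (fun x y => by
          have h1 := hlip n x y
          have h2 := hglip x y
          simp only [hDdef, BoundedContinuousFunction.sub_apply]
          rw [abs_le] at *
          constructor <;> linarith) y
      simpa [hy, hq0] using this
  have hi : Integrable ({y : Y | y ≠ ⊥}.indicator (fun _ => 2 * s)) (P n) :=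
    (integrable_const _).indicator hm
  rw [abs_mul, Nat.abs_cast]
  calc (n : ℝ) * |∫ y, (D y - D ⊥) ∂P n|
      ≤ n * ∫ y, ((q J y - q J ⊥) + {y : Y | y ≠ ⊥}.indicator (fun _ => 2 * s) y) ∂P n := by
        gcongr
        exact norm_integral_le_of_norm_le (f := fun y => D y - D ⊥)
          (g := fun y => (q J y - q J ⊥) + {y : Y | y ≠ ⊥}.indicator (fun _ => 2 * s) y)
          ((hint _ _).add hi) (ae_of_all _ hpt)
    _ = n * ∫ y, (q J y - q J ⊥) ∂P n + 2 * s * (n * (P n).real {y | y ≠ ⊥}) := by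
        rw [integral_add (hint _ _) hi, integral_indicator_const _ hm, smul_eq_mul]
        ring
    _ ≤ _ := by gcongr; exact hC n

/-- A Poisson limit theorem for maxima of triangular arrays in a metric semilattice. -/
theorem tendsto_supAverage_pow [SecondCountableTopology Y]
    (hY : ∀ x y z : Y, dist (x ⊔ z) (y ⊔ z) ≤ dist x y) {P : ℕ → Measure Y}
    [∀ n, IsProbabilityMeasure (P n)] {Q : Measure Y} [IsProbabilityMeasure Q] {c C : ℝ}
    (hC : ∀ n : ℕ, n * (P n).real {y | y ≠ ⊥} ≤ C)
    (hconv : ∀ h : Y →ᵇ ℝ, Tendsto (fun n : ℕ => (n : ℝ) * ∫ y, (h y - h ⊥) ∂P n) atTop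
      (𝓝 (c * ∫ y, (h y - h ⊥) ∂Q)))
    (f : Y →ᵇ ℝ) {L : ℝ} (hL : 0 ≤ L) (hf : ∀ x y, |f x - f y| ≤ L * dist x y) (x : Y) :
    Tendsto (fun n => (supAverage (P n) ^ n) f x) atTop
      (𝓝 (∑' k : ℕ, Real.exp (-c) * c ^ k / k.factorial * (supAverage Q ^ k) f x)) := by
  have hC0 : 0 ≤ C := by simpa using hC 0
  let G : ℕ → (Y →ᵇ ℝ) →L[ℝ] (Y →ᵇ ℝ) := fun n => supGenerator n (P n)
  have hnorm : ∀ n k, ‖(G n ^ k) f‖ ≤ (2 * C) ^ k * ‖f‖ := by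
    intro n k
    induction k with
    | zero => simp
    | succ k ih =>
      rw [pow_succ', mul_apply_eq_comp, pow_succ', mul_assoc]
      exact (norm_supGenerator_apply_le n.cast_nonneg _ (hC n) _).trans (by gcongr)
  have hlip : ∀ n k x y, |(G n ^ k) f x - (G n ^ k) f y| ≤ (2 * C) ^ k * L * dist x y := by
    intro n k
    induction k with
    | zero => simpa using hf
    | succ k ih =>
      intro x y
      rw [pow_succ', mul_apply_eq_comp, pow_succ', mul_assoc (2 * C)]
      exact supGenerator_lipschitz hY n.cast_nonneg _ (hC n) _ (by positivity) ih x y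
  have hlim : ∀ k x, Tendsto (fun n => (G n ^ k) f x) atTop (𝓝 ((supGenerator c Q ^ k) f x)) := by
    intro k
    induction k with
    | zero => simp
    | succ k ih =>
      intro x
      simp only [pow_succ', mul_apply_eq_comp, G, supGenerator_apply]
      have hxlip : ∀ y z, dist (x ⊔ y) (x ⊔ z) ≤ dist y z := fun y z => by
        simpa only [sup_comm x] using hY y z x
      -- One more factor `G n` at `x` integrates the increments of the shifted function `(G n ^ k f)
      -- (x ⊔ ·)`. Its uniform bounds pass to the pointwise limit, as the extended convergence
      -- requires.
      let sh : (Y →ᵇ ℝ) → (Y →ᵇ ℝ) := fun h => h.compContinuous ⟨fun y => x ⊔ y, by fun_prop⟩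
      have hLk : 0 ≤ (2 * C) ^ k * L := by positivity
      have hb : ∀ n y, |(G n ^ k) f y| ≤ (2 * C) ^ k * ‖f‖ := fun n y =>
        ((G n ^ k) f).norm_coe_le_norm y |>.trans (hnorm n k)
      refine tendsto_mul_integral_increment hC hconv (h := fun n => sh ((G n ^ k) f))
        (g := sh ((supGenerator c Q ^ k) f)) (K := (2 * C) ^ k * ‖f‖) (L := (2 * C) ^ k * L)
        (by positivity) hLk (fun n y => hb n _)
        (fun y => le_of_tendsto (ih _).abs (.of_forall fun n => hb n _))
        (fun n y z => (hlip n k _ _).trans (mul_le_mul_of_nonneg_left (hxlip y z) hLk))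
        (fun y z => (le_of_tendsto ((ih _).sub (ih _)).abs (.of_forall fun n => hlip n k _ _)).trans
          (mul_le_mul_of_nonneg_left (hxlip y z) hLk)) (fun y => ih _)
  have hbin : ∀ n : ℕ, 1 ≤ n → (supAverage (P n) ^ n) f x =
      ∑' k : ℕ, (n.choose k * (1 / n : ℝ) ^ k) * (G n ^ k) f x := by
    intro n hn
    exact pow_apply_eq_tsum_smul_sub_one hn (supAverage (P n)) (BoundedContinuousFunction.evalCLM ℝ x) f
  rw [← exp_supGenerator_apply]
  refine Tendsto.congr' ((eventually_ge_atTop 1).mono fun n hn => (hbin n hn).symm) ?_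
  -- The dominating series combines `n.choose k / n ^ k ≤ 1 / k!` with the norm bound `(2 C) ^ k
  -- ‖f‖`.
  have hsummable : Summable fun k : ℕ => (2 * C) ^ k / k.factorial * ‖f‖ :=
    (Real.summable_pow_div_factorial _).mul_right _
  refine tendsto_tsum_of_dominated_convergence hsummable (fun k => ?_) ?_
  · refine Tendsto.mul ?_ (hlim k x)
    have : Tendsto (fun n : ℕ => (n : ℝ) * (1 / n)) atTop (𝓝 1) :=
      tendsto_const_nhds.congr' ((eventually_ge_atTop 1).mono fun n hn => by
        have : (n : ℝ) ≠ 0 := by positivity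
        field_simp)
    simpa using tendsto_choose_mul_pow_atTop k this
  · filter_upwards [eventually_ge_atTop 1] with n hn k
    have hn0 : (n : ℝ) ≠ 0 := by positivity
    rw [norm_mul, Real.norm_of_nonneg (by positivity)]
    have h1 : n.choose k * (1 / n : ℝ) ^ k ≤ 1 / k.factorial := by
      calc n.choose k * (1 / n : ℝ) ^ k ≤ n ^ k / k.factorial * (1 / n : ℝ) ^ k := by
            gcongr; exact Nat.choose_le_pow_div k n
        _ = 1 / k.factorial := by rw [div_pow, one_pow]; field_simp
    calc _ ≤ 1 / (k.factorial : ℝ) * ((2 * C) ^ k * ‖f‖) := by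
          gcongr
          exact (((G n ^ k) f).norm_coe_le_norm x).trans (hnorm n k)
      _ = _ := by ring

/-- The mean of a function of the maximum of independent copies. -/
lemma integral_sup_range_eq [SecondCountableTopology Y] {Ω : Type*} [MeasurableSpace Ω]
    {P : Measure Ω} [IsProbabilityMeasure P]
    {Z : ℕ → Ω → Y} (hZ : ∀ i, AEMeasurable (Z i) P) (hind : iIndepFun Z P)
    {Q : Measure Y} [IsProbabilityMeasure Q] (hlaw : ∀ i, P.map (Z i) = Q)
    (f : Y →ᵇ ℝ) (n : ℕ) :
    ∫ ω, f ((Finset.range n).sup fun i => Z i ω) ∂P = (supAverage Q ^ n) f ⊥ := by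
  have hmeas : ∀ n, AEMeasurable (fun ω => (Finset.range n).sup fun i => Z i ω) P := by
    intro n
    induction n with
    | zero => simp
    | succ n ih =>
      simp only [Finset.range_add_one, Finset.sup_insert]
      exact (hZ n).sup ih
  induction n generalizing f with
  | zero => simp
  | succ n ih =>
    have hindep : IndepFun (fun ω => (Finset.range n).sup fun i => Z i ω) (Z n) P := by
      have h1 := hind.indepFun_finset₀ (Finset.range n) {n} (by simp) hZ
      have hφ : Measurable fun z : Finset.range n → Y => Finset.univ.sup z := by
        have : ∀ s : Finset (Finset.range n), Measurable fun z : Finset.range n → Y => s.sup z := by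
          intro s
          induction s using Finset.induction_on with
          | empty => simp
          | insert a s ha ih =>
            simp only [Finset.sup_insert]
            exact (measurable_pi_apply a).sup ih
        exact this _
      have h2 := h1.comp hφ (measurable_pi_apply (⟨n, by simp⟩ : ({n} : Finset ℕ)))
      convert h2 using 1
      · ext1 ω
        simp only [Function.comp]
        rw [← Finset.sup_attach]
        rfl
      · rfl
    have hprod := (indepFun_iff_map_prod_eq_prod_map_map (hmeas n) (hZ n)).1 hindep
    -- The last copy is integrated out first, so the induction hypothesis is needed for `supAverage
    -- Q f` and not only for `f`.
    rw [pow_succ, mul_apply_eq_comp, ← ih]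
    have hcont : Continuous fun p : Y × Y => f (p.1 ⊔ p.2) := by fun_prop
    have : IsProbabilityMeasure (P.map fun ω => (Finset.range n).sup fun i => Z i ω) :=
      Measure.isProbabilityMeasure_map (hmeas n)
    calc ∫ ω, f ((Finset.range (n + 1)).sup fun i => Z i ω) ∂P
        = ∫ ω, f (((Finset.range n).sup fun i => Z i ω) ⊔ Z n ω) ∂P := by
          simp only [Finset.range_add_one, Finset.sup_insert, sup_comm]
      _ = ∫ p, f (p.1 ⊔ p.2) ∂(P.map fun ω => ((Finset.range n).sup fun i => Z i ω, Z n ω)) :=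
          (integral_map ((hmeas n).prodMk (hZ n)) hcont.aestronglyMeasurable).symm
      _ = ∫ x, ∫ y, f (x ⊔ y) ∂Q ∂(P.map fun ω => (Finset.range n).sup fun i => Z i ω) := by
          rw [hprod, hlaw n, integral_prod]
          exact Integrable.of_bound hcont.aestronglyMeasurable ‖f‖
            (ae_of_all _ fun p => f.norm_coe_le_norm _)
      _ = ∫ ω, supAverage Q f ((Finset.range n).sup fun i => Z i ω) ∂P :=
          integral_map (hmeas n) (supAverage Q f).continuous.aestronglyMeasurable

end SupOperator

/-! ### Poisson numbers of independent points. -/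

section CompoundPoisson

variable {E : Type*} [MeasurableSpace E]

/-- The joint law of a Poisson number and of an independent sequence of independent points. -/
noncomputable def poissonSample (c : ℝ≥0) (ρ : Measure E) [IsProbabilityMeasure ρ] :
    Measure (ℕ × (ℕ → E)) :=
  (poissonMeasure c).prod (Measure.infinitePi fun _ : ℕ => ρ)

instance (c : ℝ≥0) (ρ : Measure E) [IsProbabilityMeasure ρ] :
    IsProbabilityMeasure (poissonSample c ρ) := by
  unfold poissonSample; infer_instance

/-- Vector values serve both real means of maxima and complex characteristic functions. -/
lemma integral_poissonSample {V : Type*} [NormedAddCommGroup V] [NormedSpace ℝ V]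
    [FiniteDimensional ℝ V] [MeasurableSpace V] [BorelSpace V]
    (c : ℝ≥0) (ρ : Measure E) [IsProbabilityMeasure ρ] {F : ℕ → (ℕ → E) → V}
    (hF : ∀ k, Measurable (F k)) {K : ℝ} (hb : ∀ k ξ, ‖F k ξ‖ ≤ K) :
    ∫ p, F p.1 p.2 ∂poissonSample c ρ =
      ∑' k : ℕ, (Real.exp (-c) * (c : ℝ) ^ k / k.factorial) •
        ∫ ξ, F k ξ ∂(Measure.infinitePi fun _ : ℕ => ρ) := by
  have : SecondCountableTopology V :=
    have := FiniteDimensional.proper ℝ V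
    inferInstance
  have hm : Measurable fun p : ℕ × (ℕ → E) => F p.1 p.2 :=
    measurable_from_prod_countable_right hF
  rw [poissonSample, integral_prod, integral_poissonMeasure]
  exact Integrable.of_bound hm.aestronglyMeasurable K (ae_of_all _ fun p => hb _ _)

lemma integral_prod_range_infinitePi (ρ : Measure E) [IsProbabilityMeasure ρ] {g : E → ℂ}
    (hg : Measurable g) (k : ℕ) :
    ∫ ξ, ∏ j ∈ Finset.range k, g (ξ j) ∂(Measure.infinitePi fun _ : ℕ => ρ) =
      (∫ x, g x ∂ρ) ^ k := by
  have h1 : iIndepFun (fun (j : Finset.range k) (ξ : ℕ → E) => ξ j)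
      (Measure.infinitePi fun _ : ℕ => ρ) :=
    .precomp Subtype.val_injective (iIndepFun_infinitePi (X := fun _ x => x) (by fun_prop))
  have h2 := h1.integral_fun_prod_comp (f := fun _ => g) (fun j => (measurable_pi_apply _).aemeasurable)
    (fun j => hg.aestronglyMeasurable)
  have h3 : ∀ j : ℕ, ∫ ξ, g (ξ j) ∂(Measure.infinitePi fun _ : ℕ => ρ) = ∫ x, g x ∂ρ := fun j => by
    conv_rhs => rw [← Measure.infinitePi_map_eval (fun _ : ℕ => ρ) j]
    rw [integral_map (measurable_pi_apply _).aemeasurable hg.aestronglyMeasurable]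
  simp only [h3, Finset.prod_const, Finset.card_univ, Fintype.card_coe, Finset.card_range] at h2
  rw [← h2]
  congr 1; ext ξ
  exact (Finset.prod_coe_sort (Finset.range k) fun j => g (ξ j)).symm

/-- The probability generating functional of a Poisson number of independent points. -/
lemma integral_prod_poissonSample (c : ℝ≥0) (ρ : Measure E) [IsProbabilityMeasure ρ] {g : E → ℂ}
    (hg : Measurable g) (hb : ∀ x, ‖g x‖ ≤ 1) :
    ∫ p, ∏ j ∈ Finset.range p.1, g (p.2 j) ∂poissonSample c ρ =
      Complex.exp (c * (∫ x, g x ∂ρ - 1)) := by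
  rw [integral_poissonSample c ρ (F := fun k ξ => ∏ j ∈ Finset.range k, g (ξ j)) (K := 1)
    (fun k => Finset.measurable_prod _ fun j _ => hg.comp (measurable_pi_apply j))
    (fun k ξ => by
      rw [norm_prod]
      exact Finset.prod_le_one (fun _ _ => norm_nonneg _) fun _ _ => hb _)]
  simp_rw [integral_prod_range_infinitePi ρ hg]
  set z := ∫ x, g x ∂ρ
  calc ∑' k : ℕ, (Real.exp (-c) * (c : ℝ) ^ k / k.factorial) • z ^ k
      = ∑' k : ℕ, (Real.exp (-c) : ℂ) * ((c * z) ^ k / k.factorial) := by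
        congr with k
        rw [Complex.real_smul]
        push_cast
        rw [mul_pow]
        ring
    _ = (Real.exp (-c) : ℂ) * Complex.exp (c * z) := by
        rw [tsum_mul_left, (NormedSpace.expSeries_div_hasSum_exp ((c : ℂ) * z)).tsum_eq,
          Complex.exp_eq_exp_ℂ]
    _ = Complex.exp (c * (z - 1)) := by
        rw [Complex.ofReal_exp, ← Complex.exp_add]
        push_cast
        ring_nf

lemma measurableSet_forall_lt_mem {V : Set E} (hV : MeasurableSet V) :
    MeasurableSet {p : ℕ × (ℕ → E) | ∀ j < p.1, p.2 j ∈ V} := by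
  have : {p : ℕ × (ℕ → E) | ∀ j < p.1, p.2 j ∈ V} =
      ⋂ j, ({p | j < p.1}ᶜ ∪ (fun p => p.2 j) ⁻¹' V) := by
    ext p; simp [imp_iff_not_or]
  rw [this]
  exact MeasurableSet.iInter fun j => ((measurableSet_lt measurable_const measurable_fst).compl).union
    (((measurable_pi_apply j).comp measurable_snd) hV)

/-- This is the generating functional at the indicator of `V`: the product over the points is the
indicator that all of them lie in `V`. -/
lemma poissonSample_forall_mem (c : ℝ≥0) (ρ : Measure E) [IsProbabilityMeasure ρ] {V : Set E}
    (hV : MeasurableSet V) :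
    (poissonSample c ρ).real {p | ∀ j < p.1, p.2 j ∈ V} = Real.exp (-(c * ρ.real Vᶜ)) := by
  have h := integral_prod_poissonSample c ρ (g := V.indicator 1)
    (measurable_one.indicator hV) (fun x => by by_cases hx : x ∈ V <;> simp [hx])
  have h1 : ∀ p : ℕ × (ℕ → E), ∏ j ∈ Finset.range p.1, V.indicator (1 : E → ℂ) (p.2 j) =
      {p : ℕ × (ℕ → E) | ∀ j < p.1, p.2 j ∈ V}.indicator 1 p := by
    intro p
    by_cases hp : ∀ j < p.1, p.2 j ∈ V
    · rw [indicator_of_mem (by exact hp)]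
      exact Finset.prod_eq_one fun j hj => by simp [hp j (by simpa using hj)]
    · rw [indicator_of_notMem (by exact hp)]
      push Not at hp
      obtain ⟨j, hj, hjV⟩ := hp
      exact Finset.prod_eq_zero (Finset.mem_range.2 hj) (by simp [hjV])
  simp_rw [h1] at h
  have h2 : ∀ {α : Type _} [MeasurableSpace α] (μ : Measure α) {s : Set α}, MeasurableSet s →
      ∫ x, s.indicator (1 : α → ℂ) x ∂μ = μ.real s := fun μ s hs =>
    (integral_indicator_const (1 : ℂ) hs).trans (by simp)
  rw [h2 _ (measurableSet_forall_lt_mem hV), h2 _ hV] at h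
  rw [← Complex.ofReal_inj, h, Complex.ofReal_exp, probReal_compl_eq_one_sub hV]
  push_cast
  ring_nf

/-- The zero measure is written as weight `0` times an arbitrary point mass, whence the need for a
point. -/
lemma exists_isProbabilityMeasure_smul_eq [Nonempty E] (μ : Measure E) [IsFiniteMeasure μ] :
    ∃ ρ : Measure E, IsProbabilityMeasure ρ ∧ μ = μ univ • ρ := by
  by_cases h : μ = 0
  · exact ⟨Measure.dirac (Classical.arbitrary E), inferInstance, by simp [h]⟩
  · have h0 : μ univ ≠ 0 := by simpa using h
    have : NeZero μ := ⟨h⟩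
    refine ⟨(μ univ)⁻¹ • μ, inferInstance, ?_⟩
    rw [smul_smul, ENNReal.mul_inv_cancel h0 (measure_ne_top _ _), one_smul]

end CompoundPoisson

/-! ### The mean of a function of a compound Poisson maximum. -/

section CompoundSup

variable {Y : Type*} [MetricSpace Y] [SemilatticeSup Y] [OrderBot Y] [ContinuousSup Y]
  [MeasurableSpace Y] [BorelSpace Y] [SecondCountableTopology Y]

lemma measurable_sup_range (k : ℕ) : Measurable fun ξ : ℕ → Y => (Finset.range k).sup ξ := by
  induction k with
  | zero => simp
  | succ k ih =>
    simp only [Finset.range_add_one, Finset.sup_insert]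
    exact (measurable_pi_apply k).sup ih

/-- Conditioning on the number of points yields exactly the limit series of
`tendsto_supAverage_pow`. -/
lemma integral_sup_poissonSample (c : ℝ≥0) (Q : Measure Y) [IsProbabilityMeasure Q] (f : Y →ᵇ ℝ) :
    ∫ p, f ((Finset.range p.1).sup p.2) ∂poissonSample c Q =
      ∑' k : ℕ, Real.exp (-c) * (c : ℝ) ^ k / k.factorial * (supAverage Q ^ k) f ⊥ := by
  rw [integral_poissonSample c Q (F := fun k ξ => f ((Finset.range k).sup ξ)) (K := ‖f‖)
    (fun k => f.continuous.measurable.comp (measurable_sup_range k))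
    (fun k ξ => f.norm_coe_le_norm _)]
  congr with k
  rw [smul_eq_mul, integral_sup_range_eq (Z := fun j (ξ : ℕ → Y) => ξ j)
    (fun i => (measurable_pi_apply i).aemeasurable)
    (iIndepFun_infinitePi (X := fun _ x => x) (by fun_prop))
    (fun i => Measure.infinitePi_map_eval (fun _ : ℕ => Q) i)]

end CompoundSup

/-! ### Existence of Poisson point processes. -/

section PoissonExistence

variable {E : Type*} [MeasurableSpace E]

/-- The number of the first `(ω k).1` points of the `k`-th sequences, `k < K`, lying in `A k ∩ B`. -/
noncomputable def sampleCount (A : ℕ → Set E) (K : ℕ) (B : Set E) (ω : ℕ → ℕ × (ℕ → E)) : ℝ :=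
  ∑ k ∈ Finset.range K, ∑ j ∈ Finset.range (ω k).1, (A k ∩ B).indicator 1 ((ω k).2 j)

lemma measurable_sum_range_sample {R : Type*} [AddCommMonoid R] [MeasurableSpace R]
    [MeasurableAdd₂ R] {g : E → R} (hg : Measurable g) (k : ℕ) :
    Measurable fun ω : ℕ → ℕ × (ℕ → E) => ∑ j ∈ Finset.range (ω k).1, g ((ω k).2 j) := by
  have : Measurable fun p : ℕ × (ℕ → E) => ∑ j ∈ Finset.range p.1, g (p.2 j) :=
    measurable_from_prod_countable_right
      fun n => Finset.measurable_sum (Finset.range n) fun j _ => hg.comp (measurable_pi_apply j)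
  exact this.comp (measurable_pi_apply k)

lemma measurable_sampleCount {A : ℕ → Set E} (hA : ∀ k, MeasurableSet (A k)) (K : ℕ) {B : Set E}
    (hB : MeasurableSet B) : Measurable (sampleCount A K B) :=
  Finset.measurable_sum _ fun k _ =>
    measurable_sum_range_sample (measurable_one.indicator ((hA k).inter hB)) k

/-- The joint characteristic function of the numbers of points in disjoint sets. -/
lemma integral_exp_sampleCount {A : ℕ → Set E} (hA : ∀ k, MeasurableSet (A k))
    (hAd : Pairwise (fun k l => Disjoint (A k) (A l))) {ν : Measure E}
    (c : ℕ → ℝ≥0) (ρ : ℕ → Measure E) [∀ k, IsProbabilityMeasure (ρ k)]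
    (hρ : ∀ k, ν.restrict (A k) = (c k : ℝ≥0∞) • ρ k) {K : ℕ}
    {ι : Type*} [Fintype ι] {B : ι → Set E} (hB : ∀ l, MeasurableSet (B l))
    (hBd : Pairwise (fun l m => Disjoint (B l) (B m))) (hBν : ∀ l, ν (B l) ≠ ∞)
    (hBA : ∀ l, ν (B l \ ⋃ k ∈ Finset.range K, A k) = 0) (t : ι → ℝ) :
    ∫ ω, Complex.exp (∑ l, t l * sampleCount A K (B l) ω * Complex.I)
        ∂(Measure.infinitePi fun k => poissonSample (c k) (ρ k)) =
      ∏ l, Complex.exp (ν.real (B l) * (Complex.exp (t l * Complex.I) - 1)) := by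
  let g : ℕ → E → ℂ := fun k x =>
    Complex.exp (∑ l, t l * (A k ∩ B l).indicator (1 : E → ℝ) x * Complex.I)
  have hind : ∀ k l, Measurable ((A k ∩ B l).indicator (1 : E → ℝ)) := fun k l =>
    measurable_one.indicator ((hA k).inter (hB l))
  have hg : ∀ k, Measurable (g k) := fun k =>
    Complex.measurable_exp.comp (Finset.measurable_sum _ fun l _ =>
      ((Complex.measurable_ofReal.comp (hind k l)).const_mul _).mul_const _)
  have hg1 : ∀ k x, ‖g k x‖ ≤ 1 := fun k x => by
    have : ∑ l, (t l : ℂ) * (A k ∩ B l).indicator (1 : E → ℝ) x * Complex.I =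
      ((∑ l, t l * (A k ∩ B l).indicator (1 : E → ℝ) x : ℝ) : ℂ) * Complex.I := by
      push_cast; rw [Finset.sum_mul]
    simp only [g]
    rw [this, Complex.norm_exp_ofReal_mul_I]
  have hexp : ∀ ω, Complex.exp (∑ l, t l * sampleCount A K (B l) ω * Complex.I) =
      ∏ k ∈ Finset.range K, ∏ j ∈ Finset.range (ω k).1, g k ((ω k).2 j) := by
    intro ω
    simp only [g, ← Complex.exp_sum, sampleCount]
    congr 1
    push_cast
    simp only [Finset.mul_sum, Finset.sum_mul]
    rw [Finset.sum_comm]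
    exact Finset.sum_congr rfl fun k _ => Finset.sum_comm
  -- By disjointness each point lies in at most one `B l`, so the exponential of the sum becomes
  -- affine in the indicators and can be integrated term by term.
  have hg' : ∀ k x, g k x = 1 + ∑ l, (A k ∩ B l).indicator
      (fun _ => Complex.exp (t l * Complex.I) - 1) x := by
    intro k x
    by_cases hx : ∃ l, x ∈ A k ∩ B l
    · obtain ⟨l, hl⟩ := hx
      have hne : ∀ m, m ≠ l → x ∉ A k ∩ B m := fun m hm hxm =>
        (Set.disjoint_left.1 (hBd hm) hxm.2 hl.2)
      simp only [g]
      rw [Finset.sum_eq_single l (fun m _ hm => by simp [indicator_of_notMem (hne m hm)]) (by simp),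
        Finset.sum_eq_single l (fun m _ hm => by rw [indicator_of_notMem (hne m hm)]) (by simp),
        indicator_of_mem hl, indicator_of_mem hl]
      simp
    · push Not at hx
      simp [g, hx]
  have hint : ∀ k, (c k : ℂ) * (∫ x, g k x ∂ρ k - 1) =
      ∑ l, ν.real (A k ∩ B l) * (Complex.exp (t l * Complex.I) - 1) := by
    intro k
    have hi : ∀ l, Integrable ((A k ∩ B l).indicator
        (fun _ => Complex.exp (t l * Complex.I) - 1)) (ρ k) := fun l =>
      (integrable_const _).indicator ((hA k).inter (hB l))
    simp_rw [hg']
    rw [integral_add (integrable_const _) (integrable_finsetSum _ fun l _ => hi l),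
      integral_finsetSum _ fun l _ => hi l]
    simp only [integral_const, probReal_univ, one_smul, add_sub_cancel_left, Finset.mul_sum]
    refine Finset.sum_congr rfl fun l _ => ?_
    have : ν.real (A k ∩ B l) = c k * (ρ k).real (A k ∩ B l) := by
      have h := congrArg (fun μ => μ (A k ∩ B l)) (hρ k)
      simp only [Measure.restrict_apply ((hA k).inter (hB l)), Measure.smul_apply, smul_eq_mul] at h
      rw [inter_eq_left.2 inter_subset_left] at h
      simp [measureReal_def, h]
    rw [integral_indicator_const _ ((hA k).inter (hB l)), this, Complex.real_smul]
    push_cast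
    ring
  have hsum : ∀ l, ∑ k ∈ Finset.range K, ν.real (A k ∩ B l) = ν.real (B l) := by
    intro l
    rw [← measureReal_biUnion_finset
      (fun i _ j _ hij => (hAd hij).mono inter_subset_left inter_subset_left)
      (fun k _ => (hA k).inter (hB l))
      (fun k _ => measure_ne_top_of_subset inter_subset_right (hBν l)), measureReal_def,
      measureReal_def]
    congr 1
    rw [← iUnion₂_inter, inter_comm]
    refine le_antisymm (measure_mono inter_subset_left) ?_
    refine (measure_le_inter_add_sdiff ν (B l) (⋃ k ∈ Finset.range K, A k)).trans_eq ?_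
    rw [hBA l, add_zero]
  have hindep : iIndepFun (fun (k : Finset.range K) (ω : ℕ → ℕ × (ℕ → E)) => ω k)
      (Measure.infinitePi fun k => poissonSample (c k) (ρ k)) :=
    .precomp Subtype.val_injective (iIndepFun_infinitePi (X := fun _ x => x) (by fun_prop))
  have hGm : ∀ k, Measurable fun p : ℕ × (ℕ → E) => ∏ j ∈ Finset.range p.1, g k (p.2 j) :=
    fun k => measurable_from_prod_countable_right
      fun n => Finset.measurable_prod (Finset.range n) fun j _ => (hg k).comp (measurable_pi_apply j)
  have hprod := hindep.integral_fun_prod_comp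
    (f := fun (k : Finset.range K) (p : ℕ × (ℕ → E)) => ∏ j ∈ Finset.range p.1, g k (p.2 j))
    (fun k => (measurable_pi_apply _).aemeasurable) (fun k => (hGm k).aestronglyMeasurable)
  have heval : ∀ k : ℕ, ∫ ω, ∏ j ∈ Finset.range (ω k).1, g k ((ω k).2 j)
      ∂(Measure.infinitePi fun k => poissonSample (c k) (ρ k)) =
        Complex.exp (c k * (∫ x, g k x ∂ρ k - 1)) := by
    intro k
    rw [← integral_prod_poissonSample (c k) (ρ k) (hg k) (hg1 k)]
    conv_rhs => rw [← Measure.infinitePi_map_eval (fun k => poissonSample (c k) (ρ k)) k]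
    rw [integral_map (measurable_pi_apply _).aemeasurable (hGm k).aestronglyMeasurable]
  simp_rw [hexp]
  calc _ = ∏ k : Finset.range K, Complex.exp (c k * (∫ x, g k x ∂ρ k - 1)) := by
        simp_rw [← heval]
        rw [← hprod]
        congr 1; ext ω
        exact (Finset.prod_coe_sort (Finset.range K)
          fun k => ∏ j ∈ Finset.range (ω k).1, g k ((ω k).2 j)).symm
    _ = ∏ k ∈ Finset.range K, Complex.exp (c k * (∫ x, g k x ∂ρ k - 1)) :=
        Finset.prod_coe_sort (Finset.range K)
          fun k => Complex.exp (c k * (∫ x, g k x ∂ρ k - 1))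
    _ = _ := by
        simp_rw [hint, ← Complex.exp_sum]
        rw [Finset.sum_comm]
        congr 1
        refine Finset.sum_congr rfl fun l _ => ?_
        rw [← Finset.sum_mul, ← hsum l]
        push_cast
        rfl

lemma pointMeasure_apply {I : Set ℕ} (x : I → E) {B : Set E} (hB : MeasurableSet B) :
    pointMeasure x B = ∑' i : I, B.indicator 1 (x i) := by
  rw [pointMeasure, Measure.sum_apply _ hB]
  simp_rw [Measure.dirac_apply' _ hB]

/-- The points `(ω k).2 j ∈ A k`, `j < (ω k).1`, enumerated by the codes of the pairs `(k, j)`. -/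
def sampleIndex (A : ℕ → Set E) (ω : ℕ → ℕ × (ℕ → E)) : Set ℕ :=
  {i | i.unpair.2 < (ω i.unpair.1).1 ∧ (ω i.unpair.1).2 i.unpair.2 ∈ A i.unpair.1}

lemma pointMeasure_sampleIndex_apply (A : ℕ → Set E) (ω : ℕ → ℕ × (ℕ → E)) {B : Set E}
    (hB : MeasurableSet B) :
    pointMeasure (fun i : sampleIndex A ω => (ω (i : ℕ).unpair.1).2 (i : ℕ).unpair.2) B =
      ∑' k, ∑ j ∈ Finset.range (ω k).1, (A k ∩ B).indicator (1 : E → ℝ≥0∞) ((ω k).2 j) := by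
  classical
  rw [pointMeasure_apply _ hB,
    tsum_subtype (sampleIndex A ω) fun i => B.indicator 1 ((ω i.unpair.1).2 i.unpair.2)]
  let F : ℕ × ℕ → ℝ≥0∞ := fun p =>
    if p.2 < (ω p.1).1 then (A p.1 ∩ B).indicator 1 ((ω p.1).2 p.2) else 0
  have hF : ∀ i, (sampleIndex A ω).indicator
      (fun i => B.indicator (1 : E → ℝ≥0∞) ((ω i.unpair.1).2 i.unpair.2)) i =
        F (Nat.pairEquiv.symm i) := by
    intro i
    simp only [F, Nat.pairEquiv_symm_apply, indicator_apply, sampleIndex, mem_ofPred_eq, mem_inter_iff]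
    split_ifs <;> simp_all
  simp_rw [hF]
  rw [Nat.pairEquiv.symm.tsum_eq, ENNReal.tsum_prod (f := fun a b => F (a, b))]
  congr 1; ext k
  rw [tsum_eq_sum (s := Finset.range (ω k).1) (fun j hj => by
    simp only [F]
    rw [if_neg (by simpa using hj)])]
  exact Finset.sum_congr rfl fun j hj => if_pos (by simpa using hj)

/-- Poisson point processes exist: with points in a prescribed set `G` of full measure. -/
theorem exists_isPoissonPointProcess {E : Type u} [PseudoMetricSpace E] [MeasurableSpace E]
    [OpensMeasurableSpace E] [Nonempty E] {ν : Measure E} (hν : IsBoundedlyFinite ν) {G : Set E}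
    (hG : MeasurableSet G) (hνG : ν Gᶜ = 0) :
    ∃ (Ω' : Type u) (_ : MeasurableSpace Ω') (P' : Measure Ω') (_ : IsProbabilityMeasure P')
      (I : Ω' → Set ℕ) (x : ∀ ω, I ω → E), (∀ ω i, x ω i ∈ G) ∧
      IsPoissonPointProcess (fun ω => pointMeasure (x ω)) ν P' := by
  let x₀ : E := Classical.arbitrary E
  -- Shells of integer distance: each is bounded, hence of finite mass, and a bounded set meets only
  -- finitely many.
  let A : ℕ → Set E := fun k => G ∩ {x | ⌊dist x x₀⌋₊ = k}
  have hA : ∀ k, MeasurableSet (A k) := fun k => hG.inter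
    
    ((Nat.measurable_floor.comp (continuous_id.dist continuous_const).measurable)
      (measurableSet_singleton k))
  have hAd : Pairwise fun k l => Disjoint (A k) (A l) := fun k l hkl =>
    Set.disjoint_left.2 fun x hk hl => hkl (hk.2.symm.trans hl.2)
  have hAb : ∀ k, Bornology.IsBounded (A k) := fun k =>
    (Metric.isBounded_ball (x := x₀) (r := k + 1)).subset fun x hx => by
      rw [Metric.mem_ball, ← hx.2]
      exact Nat.lt_floor_add_one _
  have hfin : ∀ k, IsFiniteMeasure (ν.restrict (A k)) := fun k =>
    isFiniteMeasure_restrict.2 (hν _ (hA k) (hAb k)).ne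
  choose ρ hρp hρ using fun k => exists_isProbabilityMeasure_smul_eq (ν.restrict (A k))
  let c : ℕ → ℝ≥0 := fun k => (ν.restrict (A k) univ).toNNReal
  have hρ' : ∀ k, ν.restrict (A k) = (c k : ℝ≥0∞) • ρ k := fun k => by
    rw [ENNReal.coe_toNNReal (measure_ne_top _ _)]
    exact hρ k
  have hbd : ∀ B : Set E, Bornology.IsBounded B → ∃ K : ℕ, ∀ K' ≥ K, ∀ x ∈ B, ⌊dist x x₀⌋₊ < K' := by
    intro B hB
    obtain ⟨R, hR⟩ := hB.subset_ball x₀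
    refine ⟨⌈R⌉₊, fun K' hK' x hx => ?_⟩
    exact Nat.floor_lt' (by
      have : 0 < R := dist_nonneg.trans_lt (hR hx)
      have := Nat.ceil_pos.2 this
      omega) |>.2 ((Metric.mem_ball.1 (hR hx)).trans_le ((Nat.le_ceil R).trans (by exact_mod_cast hK')))
  let x : ∀ ω : ℕ → ℕ × (ℕ → E), sampleIndex A ω → E :=
    fun ω i => (ω (i : ℕ).unpair.1).2 (i : ℕ).unpair.2
  -- `sampleIndex` discards sampled points outside their shell, so membership in `G` and local
  -- finiteness hold for every `ω`, not just almost surely.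
  have hxA : ∀ ω (i : sampleIndex A ω), x ω i ∈ A (i : ℕ).unpair.1 := fun ω i => i.2.2
  let P' := Measure.infinitePi fun k => poissonSample (c k) (ρ k)
  have hcount : ∀ B : Set E, MeasurableSet B → ∀ K : ℕ, (∀ x ∈ B, ⌊dist x x₀⌋₊ < K) → ∀ ω,
      pointMeasure (x ω) B = ENNReal.ofReal (sampleCount A K B ω) := by
    intro B hB K hK ω
    have hnn : ∀ k j, 0 ≤ (A k ∩ B).indicator (1 : E → ℝ) ((ω k).2 j) := fun k j =>
      indicator_nonneg (fun _ _ => zero_le_one) _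
    rw [pointMeasure_sampleIndex_apply A ω hB, sampleCount,
      ENNReal.ofReal_sum_of_nonneg fun k _ => Finset.sum_nonneg fun j _ => hnn k j,
      tsum_eq_sum (s := Finset.range K) fun k hk => Finset.sum_eq_zero fun j _ =>
        indicator_of_notMem (fun h : (ω k).2 j ∈ A k ∩ B => hk (Finset.mem_range.2 (h.1.2 ▸ hK _ h.2))) _]
    refine Finset.sum_congr rfl fun k _ => ?_
    rw [ENNReal.ofReal_sum_of_nonneg fun j _ => hnn k j]
    refine Finset.sum_congr rfl fun j _ => ?_
    by_cases h : (ω k).2 j ∈ A k ∩ B <;> simp [h]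
  have hνA : ∀ (B : Set E) (K : ℕ), (∀ x ∈ B, ⌊dist x x₀⌋₊ < K) →
      ν (B \ ⋃ k ∈ Finset.range K, A k) = 0 := fun B K hK =>
    measure_mono_null (fun y hy (hyG : y ∈ G) => hy.2 (by
      simp only [mem_iUnion, Finset.mem_range]
      exact ⟨_, hK y hy.1, hyG, rfl⟩)) hνG
  -- The joint characteristic function for a single set gives the Poisson law of one count.
  have hchar : ∀ B : Set E, MeasurableSet B → Bornology.IsBounded B → ∀ K : ℕ,
      (∀ x ∈ B, ⌊dist x x₀⌋₊ < K) →
      P'.map (sampleCount A K B) = (poissonMeasure (ν B).toNNReal).map (Nat.cast : ℕ → ℝ) := by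
    intro B hB hBb K hK
    have hm := measurable_sampleCount hA K hB
    have : IsProbabilityMeasure (P'.map (sampleCount A K B)) :=
      Measure.isProbabilityMeasure_map hm.aemeasurable
    refine Measure.ext_of_charFun (funext fun t => ?_)
    have h := integral_exp_sampleCount hA hAd c ρ hρ' (ι := Unit) (B := fun _ => B) (K := K)
      (fun _ => hB) (fun i j hij => (hij rfl).elim) (fun _ => (hν B hB hBb).ne)
      (fun _ => hνA B K hK) (fun _ => t)
    simp only [Finset.univ_unique, Finset.sum_singleton, Finset.prod_singleton] at h
    rw [charFun_map_cast_poissonMeasure, charFun_apply_real,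
      integral_map hm.aemeasurable (by fun_prop), h]
    rfl
  refine ⟨ℕ → ℕ × (ℕ → E), inferInstance, P', inferInstance, sampleIndex A, x,
    fun ω i => (hxA ω i).1, ?_, fun ω => ⟨_, x ω, fun B hB => ?_, rfl⟩, fun B hB hBb => ?_,
    fun m B hB hBb hBd => ?_⟩
  · refine Measure.measurable_of_measurable_coe _ fun B hB => ?_
    simp_rw [x, pointMeasure_sampleIndex_apply A _ hB]
    exact Measurable.tsum fun k =>
      measurable_sum_range_sample (measurable_one.indicator ((hA k).inter hB)) k
  · obtain ⟨K, hK⟩ := hbd B hB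
    refine Set.Finite.preimage Subtype.val_injective.injOn (s := _) ?_ |>.subset
      (s := Subtype.val ⁻¹' (⋃ k ∈ Finset.range K, (fun j => Nat.pair k j) '' Iio (ω k).1)) ?_
    · exact (Finset.range K).finite_toSet.biUnion fun k _ => (finite_Iio _).image _
    · intro i hi
      simp only [mem_preimage, mem_iUnion, Finset.mem_range]
      exact ⟨_, (hxA ω i).2 ▸ hK K le_rfl _ hi, _, i.2.1, Nat.pair_unpair _⟩
  · obtain ⟨K, hK⟩ := hbd B hBb
    have h1 := congrArg (Measure.map ENNReal.ofReal) (hchar B hB hBb K (hK K le_rfl))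
    rw [Measure.map_map ENNReal.measurable_ofReal (measurable_sampleCount hA K hB),
      Measure.map_map ENNReal.measurable_ofReal .of_discrete] at h1
    simp_rw [hcount B hB K (hK K le_rfl)]
    refine h1.trans ?_
    congr 1; ext n
    simp
  · choose K hK using fun j => hbd (B j) (hBb j)
    -- One number of shells covering all the sets `B j` at once.
    let K' := ∑ j, K j
    have hK' : ∀ j, ∀ x ∈ B j, ⌊dist x x₀⌋₊ < K' := fun j =>
      hK j K' (Finset.single_le_sum (f := K) (fun _ _ => Nat.zero_le _) (Finset.mem_univ j))
    have hm := fun j => measurable_sampleCount hA K' (hB j)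
    have hind : iIndepFun (fun j => sampleCount A K' (B j)) P' := by
      refine (iIndepFun_iff_charFun_pi fun j => (hm j).aemeasurable).2 fun t => ?_
      have h := integral_exp_sampleCount hA hAd c ρ hρ' (B := B) (K := K') hB hBd
        (fun j => (hν _ (hB j) (hBb j)).ne) (fun j => hνA _ _ (hK' j)) t
      rw [charFun_apply, integral_map (by fun_prop) (by fun_prop)]
      refine Eq.trans (integral_congr_ae (ae_of_all _ fun ω => ?_)) (h.trans ?_)
      · simp only [PiLp.inner_apply, Real.inner_apply]
        push_cast
        rw [Finset.sum_mul]
        congr 1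
        exact Finset.sum_congr rfl fun l _ => by ring
      · refine Finset.prod_congr rfl fun j _ => ?_
        rw [hchar (B j) (hB j) (hBb j) K' (hK' j), charFun_map_cast_poissonMeasure]
        rfl
    have := hind.comp (fun _ => ENNReal.ofReal) (fun _ => ENNReal.measurable_ofReal)
    convert this using 2 with j
    ext ω
    exact hcount (B j) (hB j) K' (hK' j) ω

end PoissonExistence

/-! ### The lattice and Borel structure of continuous functions. -/

section ContinuousFunctions

variable {T : Type*} [MetricSpace T] [CompactSpace T]

lemma dist_sup_sup_le_max (x y z w : C(T, ℝ)) :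
    dist (x ⊔ z) (y ⊔ w) ≤ max (dist x y) (dist z w) := by
  refine (ContinuousMap.dist_le (le_max_of_le_left dist_nonneg)).2 fun t => ?_
  exact (abs_max_sub_max_le_max _ _ _ _).trans (max_le_max (Real.dist_eq _ _ ▸
    ContinuousMap.dist_apply_le_dist t)
    (Real.dist_eq _ _ ▸ ContinuousMap.dist_apply_le_dist t))

instance instContinuousSupCont : ContinuousSup C(T, ℝ) where
  continuous_sup := by
    refine (LipschitzWith.of_dist_le_mul (K := 1) fun p q => ?_).continuous
    rw [NNReal.coe_one, one_mul, Prod.dist_eq]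
    exact dist_sup_sup_le_max _ _ _ _

/-- The cone of nonnegative continuous functions, a semilattice with least element `0`. -/
abbrev NonnegCont (T : Type*) [MetricSpace T] [CompactSpace T] : Type _ := Ici (0 : C(T, ℝ))

instance instContinuousSupNonnegCont : ContinuousSup (NonnegCont T) where
  continuous_sup := by
    refine Continuous.subtype_mk ?_ _
    exact (continuous_subtype_val.comp continuous_fst).sup (continuous_subtype_val.comp continuous_snd)

lemma dist_sup_sup_le_max_nonneg (x y z w : NonnegCont T) :
    dist (x ⊔ z) (y ⊔ w) ≤ max (dist x y) (dist z w) :=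
  dist_sup_sup_le_max x.1 y.1 z.1 w.1

/-- The bound does not grow with the number of functions, so truncating each of the `n` copies costs
one `δ` in total. -/
lemma dist_finset_sup_le {ι : Type*} (s : Finset ι) (a b : ι → NonnegCont T) {δ : ℝ} (hδ : 0 ≤ δ)
    (h : ∀ i ∈ s, dist (a i) (b i) ≤ δ) : dist (s.sup a) (s.sup b) ≤ δ := by
  classical
  induction s using Finset.induction_on with
  | empty => simpa using hδ
  | insert i s hi ih =>
    rw [Finset.sup_insert, Finset.sup_insert]
    exact (dist_sup_sup_le_max_nonneg _ _ _ _).trans (max_le (h i (Finset.mem_insert_self _ _))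
      (ih fun j hj => h j (Finset.mem_insert_of_mem hj)))

lemma finset_sup_apply_le_iff {ι : Type*} (s : Finset ι) (a : ι → NonnegCont T) (t : T) {c : ℝ}
    (hc : 0 ≤ c) : (s.sup a).1 t ≤ c ↔ ∀ i ∈ s, (a i).1 t ≤ c := by
  classical
  induction s using Finset.induction_on with
  | empty => simpa using hc
  | insert i s hi ih =>
    rw [Finset.sup_insert, Finset.forall_mem_insert, ← ih]
    exact max_le_iff

/-- Evaluations on a countable dense set determine uniform distances, and by second countability
open sets are countable unions of balls. -/
lemma measurable_of_measurable_eval {Ω : Type*} [MeasurableSpace Ω] {Φ : Ω → C(T, ℝ)}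
    (h : ∀ t, Measurable fun ω => Φ ω t) : Measurable Φ := by
  obtain ⟨s, hsc, hsd⟩ := TopologicalSpace.exists_countable_dense T
  have hdist : ∀ x, Measurable fun ω => dist (Φ ω) x := fun x => by
    refine measurable_of_Iic fun r => ?_
    by_cases hr : 0 ≤ r
    · have : (fun ω => dist (Φ ω) x) ⁻¹' Iic r = ⋂ t ∈ s, {ω | dist (Φ ω t) (x t) ≤ r} := by
        ext ω
        simp only [mem_preimage, mem_Iic, mem_iInter, mem_ofPred_eq]
        rw [ContinuousMap.dist_le hr]
        refine ⟨fun h t _ => h t, fun h t => ?_⟩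
        exact (isClosed_le ((map_continuous (Φ ω)).dist (map_continuous x)) continuous_const).closure_subset_iff.2
          h (hsd t)
      rw [this]
      exact MeasurableSet.biInter hsc fun t _ =>
        measurableSet_le ((h t).dist measurable_const) measurable_const
    · convert MeasurableSet.empty
      ext ω
      simpa using (not_le.1 hr).trans_le dist_nonneg
  refine measurable_of_isOpen fun U hU => ?_
  choose! ε hε hεU using Metric.isOpen_iff.1 hU
  obtain ⟨S, hS, hSU⟩ := TopologicalSpace.isOpen_iUnion_countable
    (fun x : U => Metric.ball (x : C(T, ℝ)) (ε x)) fun _ => Metric.isOpen_ball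
  have hUeq : U = ⋃ x ∈ S, Metric.ball (x : C(T, ℝ)) (ε x) := by
    rw [hSU]
    exact Subset.antisymm (fun x hx => mem_iUnion.2 ⟨⟨x, hx⟩, Metric.mem_ball_self (hε x hx)⟩)
      (iUnion_subset fun x => hεU x x.2)
  rw [hUeq, preimage_iUnion₂]
  exact MeasurableSet.biUnion hS fun x _ => measurableSet_lt (hdist x) measurable_const

/-- The functions of the cone below the level `q.2` at `q.1`, for all `q ∈ F`. -/
def cylinderBelow (F : Finset (T × ℝ)) : Set (NonnegCont T) := {y | ∀ q ∈ F, y.1 q.1 ≤ q.2}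

lemma isClosed_cylinderBelow (F : Finset (T × ℝ)) : IsClosed (cylinderBelow F) := by
  simp only [cylinderBelow, ofPred_forall]
  exact isClosed_biInter fun q _ => isClosed_le
    ((continuous_eval_const q.1).comp continuous_subtype_val) continuous_const

lemma measurableSet_cylinderBelow (F : Finset (T × ℝ)) : MeasurableSet (cylinderBelow F) :=
  (isClosed_cylinderBelow F).measurableSet

/-- Lying below levels passes from the members to the maximum, which makes such sets suited to laws
of maxima. The levels must be nonnegative because the empty maximum is `0`. -/
lemma finset_sup_mem_cylinderBelow_iff {ι : Type*} (s : Finset ι) (a : ι → NonnegCont T)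
    {F : Finset (T × ℝ)} (hF : ∀ q ∈ F, 0 ≤ q.2) :
    s.sup a ∈ cylinderBelow F ↔ ∀ i ∈ s, a i ∈ cylinderBelow F := by
  simp only [cylinderBelow, mem_ofPred_eq]
  constructor
  · exact fun h i hi q hq => (finset_sup_apply_le_iff s a q.1 (hF q hq)).1 (h q hq) i hi
  · exact fun h q hq => (finset_sup_apply_le_iff s a q.1 (hF q hq)).2 fun i hi => h i hi q hq

/-- These sets are stable under intersection, by uniting the constraints, and generate all
evaluations and so the Borel sets. A negative level gives the empty set. -/
lemma ext_of_cylinderBelow {μ ν : Measure (NonnegCont T)} [IsProbabilityMeasure μ]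
    [IsProbabilityMeasure ν]
    (h : ∀ F : Finset (T × ℝ), (∀ q ∈ F, 0 ≤ q.2) → μ (cylinderBelow F) = ν (cylinderBelow F)) :
    μ = ν := by
  classical
  refine ext_of_generate_finite (range (cylinderBelow (T := T))) (le_antisymm ?_ ?_) ?_ ?_ (by simp)
  · refine measurable_iff_comap_le.1 (?_ : @Measurable _ _ (_) _ Subtype.val)
    refine @measurable_of_measurable_eval T _ _ _ (_) _ fun t => ?_
    refine @measurable_of_Iic ℝ _ _ _ _ (_) _ _ _ _ fun c => ?_
    refine MeasurableSpace.measurableSet_generateFrom ⟨{(t, c)}, ?_⟩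
    ext y
    simp [cylinderBelow]
  · refine MeasurableSpace.generateFrom_le ?_
    rintro _ ⟨F, rfl⟩
    exact measurableSet_cylinderBelow F
  · rintro _ ⟨F, rfl⟩ _ ⟨F', rfl⟩ -
    refine ⟨F ∪ F', ?_⟩
    ext y
    simp only [cylinderBelow, Finset.mem_union, or_imp, forall_and, mem_inter_iff, mem_ofPred_eq]
  · rintro _ ⟨F, rfl⟩
    by_cases hF : ∀ q ∈ F, 0 ≤ q.2
    · exact h F hF
    · push Not at hF
      obtain ⟨q, hq, hq0⟩ := hF
      have : cylinderBelow F = ∅ := eq_empty_of_forall_notMem fun y hy =>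
        absurd (hy q hq) (not_le.2 (hq0.trans_le (y.2 q.1)))
      simp [this]

lemma maxFun_eq_sup (x : ℕ → NonnegCont T) (n : ℕ) :
    maxFun (fun i => (x i).1) n = ((Finset.range n).sup x).1 := by
  induction n with
  | zero => rfl
  | succ n ih =>
    rw [maxFun, Finset.range_add_one, Finset.fold_insert Finset.notMem_range_self,
      Finset.sup_insert]
    exact congrArg ((x n).1 ⊔ ·) ih

end ContinuousFunctions

/-! ### Truncation in polar coordinates. -/

section Truncation

variable {T : Type*} [MetricSpace T] [CompactSpace T]

/-- The inverse of the radius, `0` at infinite radius. -/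
noncomputable def invRadius (p : CBarZeroPlus T) : ℝ := (p.radius⁻¹).toReal

lemma dist_cbar (p q : CBarZeroPlus T) :
    dist p q = |invRadius p - invRadius q| + ‖p.angle - q.angle‖ := rfl

lemma invRadius_nonneg (p : CBarZeroPlus T) : 0 ≤ invRadius p := ENNReal.toReal_nonneg

lemma continuous_invRadius : Continuous (invRadius (T := T)) := by
  refine (LipschitzWith.of_dist_le_mul (K := 1) fun p q => ?_).continuous
  rw [NNReal.coe_one, one_mul, dist_cbar, Real.dist_eq]
  exact le_add_of_nonneg_right (norm_nonneg _)

lemma continuous_angle : Continuous (CBarZeroPlus.angle (T := T)) := by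
  refine (LipschitzWith.of_dist_le_mul (K := 1) fun p q => ?_).continuous
  rw [NNReal.coe_one, one_mul, dist_cbar, dist_eq_norm]
  exact le_add_of_nonneg_left (abs_nonneg _)

lemma invRadius_polar (x : CZeroPlus T) : invRadius (polar x) = ‖x.1‖⁻¹ := by
  rw [invRadius, polar, ENNReal.toReal_inv, ENNReal.toReal_ofReal (norm_nonneg _)]

lemma continuous_polar : Continuous (polar (T := T)) := by
  have hne : ∀ x : CZeroPlus T, ‖x.1‖ ≠ 0 := fun x => norm_ne_zero_iff.2 x.2.2
  have h1 : Continuous fun x : CZeroPlus T => ‖x.1‖⁻¹ :=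
    continuous_subtype_val.norm.inv₀ hne
  have h2 : Continuous fun x : CZeroPlus T => ‖x.1‖⁻¹ • x.1 := h1.smul continuous_subtype_val
  refine continuous_iff_continuousAt.2 fun x => tendsto_iff_dist_tendsto_zero.2 ?_
  have h3 : Tendsto (fun y : CZeroPlus T => |‖y.1‖⁻¹ - ‖x.1‖⁻¹| +
      ‖‖y.1‖⁻¹ • y.1 - ‖x.1‖⁻¹ • x.1‖) (𝓝 x)
      (𝓝 (|‖x.1‖⁻¹ - ‖x.1‖⁻¹| + ‖‖x.1‖⁻¹ • x.1 - ‖x.1‖⁻¹ • x.1‖)) :=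
    Continuous.tendsto (by fun_prop) x
  simp only [sub_self, abs_zero, norm_zero, add_zero] at h3
  refine h3.congr fun y => ?_
  rw [dist_cbar, invRadius_polar, invRadius_polar]
  rfl

lemma exists_polar_eq {p : CBarZeroPlus T} (hp : p.radius ≠ ∞) : ∃ x : CZeroPlus T, polar x = p := by
  have hr : 0 < p.radius.toReal := ENNReal.toReal_pos p.radius_pos.ne' hp
  have hnorm : ‖p.radius.toReal • p.angle‖ = p.radius.toReal := by
    rw [norm_smul, p.norm_angle, mul_one, Real.norm_of_nonneg hr.le]
  refine ⟨⟨p.radius.toReal • p.angle, smul_nonneg hr.le p.angle_nonneg, fun h => ?_⟩, ?_⟩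
  · rw [h, norm_zero] at hnorm
    exact hr.ne hnorm
  · refine CBarZeroPlus.ext ?_ ?_
    · simp only [polar, hnorm]
      exact ENNReal.ofReal_toReal hp
    · simp only [polar, hnorm]
      rw [smul_smul, inv_mul_cancel₀ hr.ne', one_smul]

/-- Two angles are at most `2` apart, so only the inverse radius needs a bound. -/
lemma isBounded_invRadius_le (R : ℝ) : Bornology.IsBounded {p : CBarZeroPlus T | invRadius p ≤ R} := by
  refine Metric.isBounded_iff.2 ⟨R + 2, fun p hp q hq => ?_⟩
  have h1 : |invRadius p - invRadius q| ≤ R := by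
    have := invRadius_nonneg p
    have := invRadius_nonneg q
    simp only [mem_ofPred_eq] at hp hq
    rw [abs_le]; constructor <;> linarith
  have h2 := norm_sub_le p.angle q.angle
  rw [p.norm_angle, q.norm_angle] at h2
  rw [dist_cbar]
  linarith

lemma measurableSet_invRadius_le (R : ℝ) : MeasurableSet {p : CBarZeroPlus T | invRadius p ≤ R} :=
  measurableSet_le continuous_invRadius.measurable measurable_const

/-- The radius `r = 1 / u`, capped at the level `1 / δ` and then lowered by `δ`. -/
noncomputable def truncRadius (δ u : ℝ) : ℝ := max ((max u δ)⁻¹ - δ) 0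

lemma truncRadius_nonneg (δ u : ℝ) : 0 ≤ truncRadius δ u := le_max_right _ _

lemma continuous_truncRadius {δ : ℝ} (hδ : 0 < δ) : Continuous (truncRadius δ) :=
  (((continuous_id.max continuous_const).inv₀ fun _ => (lt_max_of_lt_right hδ).ne').sub
    continuous_const).max continuous_const

/-- Lowering by `δ` makes the truncation reach zero continuously at radius `δ`, instead of jumping
there. -/
lemma truncRadius_eq_zero {δ u : ℝ} (hδ : 0 < δ) (hu : δ⁻¹ ≤ u) : truncRadius δ u = 0 := by
  refine max_eq_right (sub_nonpos.2 ?_)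
  exact inv_le_of_inv_le₀ hδ (hu.trans (le_max_left _ _))

/-- The truncation of the point `(r, s)` to a nonnegative continuous function. -/
noncomputable def truncPoint (δ : ℝ) (p : CBarZeroPlus T) : NonnegCont T :=
  ⟨truncRadius δ (invRadius p) • p.angle, smul_nonneg (truncRadius_nonneg _ _) p.angle_nonneg⟩

lemma continuous_truncPoint {δ : ℝ} (hδ : 0 < δ) : Continuous (truncPoint (T := T) δ) :=
  (((continuous_truncRadius hδ).comp continuous_invRadius).smul continuous_angle).subtype_mk _

lemma truncPoint_eq_bot {δ : ℝ} (hδ : 0 < δ) {p : CBarZeroPlus T} (hp : δ⁻¹ ≤ invRadius p) :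
    truncPoint δ p = ⊥ :=
  Subtype.ext (by
    change truncRadius δ (invRadius p) • p.angle = 0
    rw [truncRadius_eq_zero hδ hp, zero_smul])

/-- The truncation of a nonnegative continuous function. -/
noncomputable def truncFun (δ : ℝ) (y : NonnegCont T) : NonnegCont T :=
  ⟨truncRadius δ ‖y.1‖⁻¹ • ‖y.1‖⁻¹ • y.1,
    Set.mem_Ici.2 (smul_nonneg (truncRadius_nonneg _ _)
      (smul_nonneg (inv_nonneg.2 (norm_nonneg _)) y.2))⟩

lemma measurable_truncFun {δ : ℝ} (hδ : 0 < δ) : Measurable (truncFun (T := T) δ) := by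
  have h : Measurable fun y : NonnegCont T => ‖y.1‖⁻¹ := measurable_subtype_coe.norm.inv
  exact (((continuous_truncRadius hδ).measurable.comp h).smul
    (h.smul measurable_subtype_coe)).subtype_mk

/-- The convention `‖0‖⁻¹ = 0` may give a nonzero truncated radius, but it multiplies the zero
function. -/
lemma truncFun_bot (δ : ℝ) : truncFun δ (⊥ : NonnegCont T) = ⊥ :=
  Subtype.ext (by
    change truncRadius δ ‖(0 : C(T, ℝ))‖⁻¹ • ‖(0 : C(T, ℝ))‖⁻¹ • (0 : C(T, ℝ)) = 0
    simp)

lemma truncPoint_polar (δ : ℝ) (x : CZeroPlus T) :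
    truncPoint δ (polar x) = truncFun δ ⟨x.1, x.2.1⟩ := by
  refine Subtype.ext ?_
  change truncRadius δ (invRadius (polar x)) • ‖x.1‖⁻¹ • x.1 = truncRadius δ ‖x.1‖⁻¹ • ‖x.1‖⁻¹ • x.1
  rw [invRadius_polar]

/-- The cap is inactive at such norms, so `y` is only shortened along its own ray, by at most `δ`.
-/
lemma dist_truncFun_le {δ : ℝ} (hδ : 0 < δ) {y : NonnegCont T} (hy : ‖y.1‖ ≤ δ⁻¹) :
    dist (truncFun δ y) y ≤ δ := by
  rw [Subtype.dist_eq]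
  change dist (truncRadius δ ‖y.1‖⁻¹ • ‖y.1‖⁻¹ • y.1) y.1 ≤ δ
  rcases (norm_nonneg y.1).eq_or_lt with h | h
  · rw [norm_eq_zero.1 h.symm]
    simpa using hδ.le
  · have h1 : δ ≤ ‖y.1‖⁻¹ := le_inv_of_le_inv₀ h hy
    have h2 : truncRadius δ ‖y.1‖⁻¹ = max (‖y.1‖ - δ) 0 := by
      rw [truncRadius, max_eq_left h1, inv_inv]
    have h3 : truncRadius δ ‖y.1‖⁻¹ • ‖y.1‖⁻¹ • y.1 - y.1 =
        ((truncRadius δ ‖y.1‖⁻¹ - ‖y.1‖) * ‖y.1‖⁻¹) • y.1 := by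
      rw [sub_mul, mul_inv_cancel₀ h.ne', sub_smul, one_smul, mul_smul]
    rw [dist_eq_norm, h3, norm_smul, norm_mul, norm_inv, norm_norm, mul_assoc,
      inv_mul_cancel₀ h.ne', mul_one, h2, Real.norm_eq_abs, abs_le]
    constructor
    · linarith [le_max_left (‖y.1‖ - δ) 0]
    · have : max (‖y.1‖ - δ) 0 ≤ ‖y.1‖ := max_le (by linarith) h.le
      linarith

/-- The vanishing of `G` at the zero function compensates for the mass dropped there by `polarLaw`.
-/
lemma integral_polarLaw {Ω : Type*} [MeasurableSpace Ω] {P : Measure Ω} {X : Ω → NonnegCont T}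
    (hXm : AEMeasurable (fun ω => (X ω).1) P) {g : CBarZeroPlus T → ℝ} (hg : Measurable g)
    {G : NonnegCont T → ℝ} (hG : Measurable G)
    (hgG : ∀ x : CZeroPlus T, g (polar x) = G ⟨x.1, x.2.1⟩) (hG0 : G ⊥ = 0) :
    ∫ p, g p ∂polarLaw (fun ω => (X ω).1) P = ∫ ω, G (X ω) ∂P := by
  -- The law lives on all of `C(T)`, so `G` is extended through the positive part.
  let G' : C(T, ℝ) → ℝ := fun x => G ⟨x ⊔ 0, Set.mem_Ici.2 le_sup_right⟩
  have hG'm : Measurable G' := hG.comp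
    ((continuous_id.sup continuous_const).measurable.subtype_mk)
  have hG' : ∀ y : NonnegCont T, G' y.1 = G y := fun y => by
    simp only [G']
    congr 1
    exact Subtype.ext (sup_eq_left.2 y.2)
  have hcl : MeasurableSet {x : C(T, ℝ) | 0 ≤ x} := by
    have : {x : C(T, ℝ) | 0 ≤ x} = ⋂ t, {x | 0 ≤ x t} := by
      ext x; simp [ContinuousMap.le_def]
    rw [this]
    exact (isClosed_iInter fun t =>
      isClosed_le continuous_const (continuous_eval_const t)).measurableSet
  have hS : MeasurableSet {x : C(T, ℝ) | 0 ≤ x ∧ x ≠ 0} :=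
    hcl.inter (measurableSet_singleton _).compl
  rw [polarLaw, integral_map continuous_polar.measurable.aemeasurable hg.aestronglyMeasurable]
  calc _ = ∫ x : CZeroPlus T, G' x.1 ∂((P.map fun ω => (X ω).1).comap Subtype.val) := by
        congr 1; ext x
        rw [hgG, ← hG']
    _ = ∫ x in {x : C(T, ℝ) | 0 ≤ x ∧ x ≠ 0}, G' x ∂(P.map fun ω => (X ω).1) :=
        integral_subtype_comap hS G'
    _ = ∫ ω in (fun ω => (X ω).1) ⁻¹' {x : C(T, ℝ) | 0 ≤ x ∧ x ≠ 0}, G' (X ω).1 ∂P :=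
        setIntegral_map hS hG'm.aestronglyMeasurable hXm
    _ = ∫ ω, G' (X ω).1 ∂P := by
        refine setIntegral_eq_integral_of_forall_compl_eq_zero fun ω hω => ?_
        rw [hG']
        have : X ω = ⊥ := by
          by_contra hne
          exact hω ⟨(X ω).2, fun h => hne (Subtype.ext h)⟩
        rw [this, hG0]
    _ = ∫ ω, G (X ω) ∂P := by simp_rw [hG']

lemma integral_smul_polarLaw {Ω : Type*} [MeasurableSpace Ω] {P : Measure Ω} {X : Ω → NonnegCont T}
    (hXm : AEMeasurable (fun ω => (X ω).1) P) {g : CBarZeroPlus T → ℝ} (hg : Measurable g)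
    {G : NonnegCont T → ℝ} (hG : Measurable G)
    (hgG : ∀ x : CZeroPlus T, g (polar x) = G ⟨x.1, x.2.1⟩) (hG0 : G ⊥ = 0) (n : ℕ) :
    ∫ p, g p ∂((n : ℝ≥0∞) • polarLaw (fun ω => (X ω).1) P) = n * ∫ ω, G (X ω) ∂P := by
  rw [integral_smul_measure, integral_polarLaw hXm hg hG hgG hG0]
  simp

/-- The bounded continuous function `φ (1 / r)` of a point `(r, s)`. -/
noncomputable def radialBCF (φ : ℝ → ℝ) (hφ : Continuous φ) (h0 : ∀ u, 0 ≤ φ u) (h1 : ∀ u, φ u ≤ 1) :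
    CBarZeroPlus T →ᵇ ℝ :=
  BoundedContinuousFunction.ofNormedAddCommGroup (fun p => φ (invRadius p))
    (hφ.comp continuous_invRadius) 1 fun p => by
      rw [Real.norm_of_nonneg (h0 _)]; exact h1 _

end Truncation

/-! ### Suprema of locally finite families of functions. -/

section PointSup

/-- The point measure may be locally finite through another enumeration. Its value on the closure of
`B`, bounded and measurable, is finite and counts the points of either enumeration. -/
lemma finite_setOf_mem_of_isBounded {E : Type*} [PseudoMetricSpace E] [MeasurableSpace E]
    [OpensMeasurableSpace E] {I : Set ℕ} {x : I → E}
    (h : IsBoundedlyFinitePointMeasure (pointMeasure x)) {B : Set E} (hB : Bornology.IsBounded B) :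
    {i | x i ∈ B}.Finite := by
  classical
  obtain ⟨J, z, hz, hxz⟩ := h
  have hcl : MeasurableSet (closure B) := isClosed_closure.measurableSet
  have hfin := hz _ hB.closure
  have hne : ∑' i : I, (closure B).indicator (1 : E → ℝ≥0∞) (x i) ≠ ∞ := by
    rw [← pointMeasure_apply x hcl, hxz, pointMeasure_apply z hcl,
      tsum_eq_sum (s := hfin.toFinset) fun j hj => indicator_of_notMem
        (fun hjB : z j ∈ closure B => hj (hfin.mem_toFinset.2 hjB)) _]
    refine (ENNReal.sum_lt_top.2 fun j _ => ?_).ne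
    exact (indicator_le_self' (fun _ _ => zero_le) _).trans_lt ENNReal.one_lt_top
  refine (ENNReal.finite_const_le_of_tsum_ne_top hne one_ne_zero).subset fun i hi => ?_
  simp [indicator_of_mem (subset_closure (show x i ∈ B from hi))]

variable {T : Type*} [MetricSpace T] [CompactSpace T]

/-- The maximum of the truncations of a family of functions, finitely many of which have norm at
least `δ`. -/
noncomputable def pointSup {J : Set ℕ} (δ : ℝ) (y : J → CZeroPlus T)
    (h : {i | polar (y i) ∈ {p : CBarZeroPlus T | invRadius p ≤ δ⁻¹}}.Finite) : NonnegCont T :=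
  h.toFinset.sup fun i => truncPoint δ (polar (y i))

/-- Points left out of the finite maximum have truncation `⊥`, which is below every nonnegative
level. -/
lemma pointSup_mem_cylinderBelow_iff {J : Set ℕ} {δ : ℝ} (hδ : 0 < δ) (y : J → CZeroPlus T)
    (h : {i | polar (y i) ∈ {p : CBarZeroPlus T | invRadius p ≤ δ⁻¹}}.Finite)
    {F : Finset (T × ℝ)} (hF : ∀ q ∈ F, 0 ≤ q.2) :
    pointSup δ y h ∈ cylinderBelow F ↔ ∀ i, truncPoint δ (polar (y i)) ∈ cylinderBelow F := by
  rw [pointSup, finset_sup_mem_cylinderBelow_iff _ _ hF]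
  refine ⟨fun H i => ?_, fun H i _ => H i⟩
  by_cases hi : invRadius (polar (y i)) ≤ δ⁻¹
  · exact H i (h.mem_toFinset.2 hi)
  · rw [truncPoint_eq_bot hδ (not_le.1 hi).le]
    exact hF

lemma pointSup_apply_le_iff {J : Set ℕ} {δ : ℝ} (hδ : 0 < δ) (y : J → CZeroPlus T)
    (h : {i | polar (y i) ∈ {p : CBarZeroPlus T | invRadius p ≤ δ⁻¹}}.Finite) (t : T) {c : ℝ}
    (hc : 0 ≤ c) :
    (pointSup δ y h).1 t ≤ c ↔ ∀ i, (truncPoint δ (polar (y i))).1 t ≤ c := by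
  simpa [cylinderBelow] using pointSup_mem_cylinderBelow_iff hδ y h (F := {(t, c)}) (by simpa using hc)

/-- Once `1 / δ` exceeds all norms, each truncation moves its point by at most `δ`; hence the
supremum is a uniform limit of finite maxima of continuous functions. -/
lemma exists_isLUB_continuousMap {J : Set ℕ} (y : J → CZeroPlus T)
    (h : ∀ R, {i | polar (y i) ∈ {p : CBarZeroPlus T | invRadius p ≤ R}}.Finite) :
    ∃ m : C(T, ℝ), (∀ t, IsLUB (insert 0 (range fun i => (y i).1 t)) (m t)) ∧
      ∀ᶠ δ in 𝓝[>] 0, dist (pointSup δ y (h δ⁻¹)).1 m ≤ δ := by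
  -- Only finitely many points have norm at least `1`, so `max R 1` bounds all norms.
  obtain ⟨R, hR⟩ := ((h 1).image fun i => ‖(y i).1‖).bddAbove
  have hpos : ∀ i, 0 < ‖(y i).1‖ := fun i => norm_pos_iff.2 (y i).2.2
  have hR' : ∀ i, ‖(y i).1‖ ≤ max R 1 := by
    intro i
    by_cases hi : invRadius (polar (y i)) ≤ 1
    · exact (hR ⟨i, hi, rfl⟩).trans (le_max_left _ _)
    · rw [invRadius_polar, not_le, one_lt_inv₀ (hpos i)] at hi
      exact hi.le.trans (le_max_right _ _)
  have hR0 : 0 < max R 1 := zero_lt_one.trans_le (le_max_right _ _)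
  let m : T → ℝ := fun t => sSup (insert 0 (range fun i => (y i).1 t))
  have hm : ∀ t, IsLUB (insert 0 (range fun i => (y i).1 t)) (m t) := fun t => by
    refine isLUB_csSup ⟨0, mem_insert _ _⟩ ⟨max R 1, ?_⟩
    rintro _ (rfl | ⟨i, rfl⟩)
    · exact hR0.le
    · exact ((le_abs_self _).trans ((y i).1.norm_coe_le_norm t)).trans (hR' i)
  have hdist : ∀ δ, 0 < δ → δ ≤ (max R 1)⁻¹ → ∀ t, dist ((pointSup δ y (h δ⁻¹)).1 t) (m t) ≤ δ := by
    intro δ hδ hδR t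
    have hRδ : max R 1 ≤ δ⁻¹ := le_inv_of_le_inv₀ hδ hδR
    have hy : ∀ i, |(truncPoint δ (polar (y i))).1 t - (y i).1 t| ≤ δ := fun i => by
      rw [truncPoint_polar, ← Real.dist_eq]
      exact (ContinuousMap.dist_apply_le_dist t).trans
        (dist_truncFun_le hδ (y := ⟨(y i).1, (y i).2.1⟩) ((hR' i).trans hRδ))
    have hm0 : 0 ≤ m t := (hm t).1 (mem_insert _ _)
    have hS0 : 0 ≤ (pointSup δ y (h δ⁻¹)).1 t := (pointSup δ y (h δ⁻¹)).2 t
    rw [Real.dist_eq, abs_le]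
    constructor
    · have : m t ≤ (pointSup δ y (h δ⁻¹)).1 t + δ := by
        refine (hm t).2 ?_
        rintro _ (rfl | ⟨i, rfl⟩)
        · positivity
        · have h1 := (pointSup_apply_le_iff hδ y (h δ⁻¹) t hS0).1 le_rfl i
          have h2 := (abs_le.1 (hy i)).1
          dsimp only
          linarith
      linarith
    · have : (pointSup δ y (h δ⁻¹)).1 t ≤ m t + δ := by
        refine (pointSup_apply_le_iff hδ y (h δ⁻¹) t (by positivity)).2 fun i => ?_
        have h1 : (y i).1 t ≤ m t := (hm t).1 (mem_insert_of_mem _ ⟨i, rfl⟩)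
        have h2 := (abs_le.1 (hy i)).2
        linarith
      linarith
  have hcont : Continuous m := by
    refine continuous_of_uniform_approx_of_continuous fun u hu => ?_
    obtain ⟨ε, hε, hεu⟩ := Metric.mem_uniformity_dist.1 hu
    have hδ : 0 < min (ε / 2) (max R 1)⁻¹ := lt_min (by positivity) (by positivity)
    refine ⟨(pointSup _ y (h (min (ε / 2) (max R 1)⁻¹)⁻¹)).1, ContinuousMap.continuous _,
      fun t => hεu ?_⟩
    rw [dist_comm]
    exact (hdist _ hδ (min_le_right _ _) t).trans_lt ((min_le_left _ _).trans_lt (by linarith))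
  refine ⟨⟨m, hcont⟩, hm, ?_⟩
  filter_upwards [Ioc_mem_nhdsGT (show (0 : ℝ) < (max R 1)⁻¹ by positivity)] with δ hδ
  exact (ContinuousMap.dist_le hδ.1.le).2 (hdist δ hδ.1 hδ.2)

end PointSup

/-! ### The law of the truncated Poisson maximum. -/

section PoissonMaximum

variable {T : Type*} [MetricSpace T] [CompactSpace T] {Ω' : Type*} [MeasurableSpace Ω']
  {P' : Measure Ω'} [IsProbabilityMeasure P'] {I : Ω' → Set ℕ} {Y : ∀ ω, I ω → CZeroPlus T}
  {ν : Measure (CBarZeroPlus T)}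

lemma IsPoissonPointProcess.finite_setOf_invRadius_le
    (hN : IsPoissonPointProcess (fun ω => _root_.pointMeasure fun i => polar (Y ω i)) ν P') (ω : Ω')
    (R : ℝ) : {i | polar (Y ω i) ∈ {p : CBarZeroPlus T | invRadius p ≤ R}}.Finite :=
  finite_setOf_mem_of_isBounded (hN.pointMeasure ω) (isBounded_invRadius_le R)

/-- The points whose truncation is not in a given cylinder. -/
def truncExceed (δ : ℝ) (F : Finset (T × ℝ)) : Set (CBarZeroPlus T) :=
  (truncPoint δ ⁻¹' cylinderBelow F)ᶜ

lemma measurableSet_truncExceed {δ : ℝ} (hδ : 0 < δ) (F : Finset (T × ℝ)) :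
    MeasurableSet (truncExceed δ F) :=
  ((continuous_truncPoint hδ).measurable (measurableSet_cylinderBelow F)).compl

lemma truncExceed_subset {δ : ℝ} (hδ : 0 < δ) {F : Finset (T × ℝ)} (hF : ∀ q ∈ F, 0 ≤ q.2) :
    truncExceed δ F ⊆ {p : CBarZeroPlus T | invRadius p ≤ δ⁻¹} := fun p hp => by
  by_contra hlt
  refine hp ?_
  rw [mem_preimage, truncPoint_eq_bot hδ (not_le.1 hlt).le]
  exact hF

/-- The maximum stays below the levels exactly when no point exceeds one of them. This reduces both
measurability and law to void events of the process. -/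
lemma IsPoissonPointProcess.pointSup_preimage
    (hN : IsPoissonPointProcess (fun ω => _root_.pointMeasure fun i => polar (Y ω i)) ν P') {δ : ℝ}
    (hδ : 0 < δ) {F : Finset (T × ℝ)} (hF : ∀ q ∈ F, 0 ≤ q.2) :
    (fun ω => pointSup δ (Y ω) (hN.finite_setOf_invRadius_le ω δ⁻¹)) ⁻¹' cylinderBelow F =
      (fun ω => _root_.pointMeasure (fun i => polar (Y ω i)) (truncExceed δ F)) ⁻¹' {0} := by
  ext ω
  rw [mem_preimage, pointSup_mem_cylinderBelow_iff hδ _ _ hF, mem_preimage, mem_singleton_iff,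
    pointMeasure_apply _ (measurableSet_truncExceed hδ F), ENNReal.tsum_eq_zero]
  refine forall_congr' fun i => ?_
  by_cases h : truncPoint δ (polar (Y ω i)) ∈ cylinderBelow F <;>
    simp [truncExceed, h]

lemma IsPoissonPointProcess.measurable_pointSup
    (hN : IsPoissonPointProcess (fun ω => _root_.pointMeasure fun i => polar (Y ω i)) ν P') {δ : ℝ}
    (hδ : 0 < δ) :
    Measurable fun ω => pointSup δ (Y ω) (hN.finite_setOf_invRadius_le ω δ⁻¹) := by
  refine Measurable.subtype_mk (f := fun ω => (pointSup δ (Y ω) _).1)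
    (measurable_of_measurable_eval fun t => measurable_of_Iic fun c => ?_)
  by_cases hc : 0 ≤ c
  · have h := hN.pointSup_preimage hδ (F := {(t, c)}) (by simpa using hc)
    have h2 : MeasurableSet ((fun ω => _root_.pointMeasure (fun i => polar (Y ω i))
        (truncExceed δ {(t, c)})) ⁻¹' {0}) :=
      ((Measure.measurable_coe (measurableSet_truncExceed hδ _)).comp hN.measurable)
        (measurableSet_singleton 0)
    rw [← h] at h2
    convert h2 using 1
    ext ω
    simp [cylinderBelow]
  · convert MeasurableSet.empty
    refine eq_empty_of_forall_notMem fun ω hω => hc ?_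
    exact ((pointSup δ (Y ω) (hN.finite_setOf_invRadius_le ω δ⁻¹)).2 t).trans hω

lemma IsPoissonPointProcess.measure_eq_zero
    (hN : IsPoissonPointProcess (fun ω => _root_.pointMeasure fun i => polar (Y ω i)) ν P')
    {W : Set (CBarZeroPlus T)} (hW : MeasurableSet W) (hWb : Bornology.IsBounded W) :
    P' ((fun ω => _root_.pointMeasure (fun i => polar (Y ω i)) W) ⁻¹' {0}) =
      ENNReal.ofReal (Real.exp (-ν.real W)) := by
  have hm : Measurable fun ω => _root_.pointMeasure (fun i => polar (Y ω i)) W :=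
    (Measure.measurable_coe hW).comp hN.measurable
  have h := congrArg (fun μ => μ {0}) (hN.map_apply W hW hWb)
  rw [Measure.map_apply hm (measurableSet_singleton 0),
    Measure.map_apply .of_discrete (measurableSet_singleton 0)] at h
  have h0 : (fun k : ℕ => (k : ℝ≥0∞)) ⁻¹' {0} = {0} := by ext k; simp
  rw [h, h0, poissonMeasure_singleton]
  simp [measureReal_def, ENNReal.coe_toNNReal_eq_toReal]

/-- The law of the maximum of the truncated points is that of the maximum of a Poisson number of
independent points. -/
lemma IsPoissonPointProcess.map_pointSup
    (hN : IsPoissonPointProcess (fun ω => _root_.pointMeasure fun i => polar (Y ω i)) ν P') {δ : ℝ}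
    (hδ : 0 < δ) {c : ℝ≥0} {ρ : Measure (CBarZeroPlus T)} [IsProbabilityMeasure ρ]
    [IsProbabilityMeasure (ρ.map (truncPoint δ))]
    (hρ : ν.restrict {p | invRadius p ≤ δ⁻¹} = (c : ℝ≥0∞) • ρ) :
    P'.map (fun ω => pointSup δ (Y ω) (hN.finite_setOf_invRadius_le ω δ⁻¹)) =
      (poissonSample c (ρ.map (truncPoint δ))).map fun p => (Finset.range p.1).sup p.2 := by
  have hm := hN.measurable_pointSup hδ
  have hm2 : Measurable fun p : ℕ × (ℕ → NonnegCont T) => (Finset.range p.1).sup p.2 :=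
    measurable_from_prod_countable_right fun k => measurable_sup_range k
  have h1 := Measure.isProbabilityMeasure_map (μ := P') hm.aemeasurable
  have h2 := Measure.isProbabilityMeasure_map
    (μ := poissonSample c (ρ.map (truncPoint δ))) hm2.aemeasurable
  refine ext_of_cylinderBelow fun F hF => ?_
  have hV := measurableSet_cylinderBelow F
  have hW := measurableSet_truncExceed hδ F
  have hpre : (fun p : ℕ × (ℕ → NonnegCont T) => (Finset.range p.1).sup p.2) ⁻¹' cylinderBelow F =
      {p | ∀ j < p.1, p.2 j ∈ cylinderBelow F} := by
    ext p
    simp [finset_sup_mem_cylinderBelow_iff _ _ hF]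
  -- The exceedance set lies where `ν` equals `c • ρ`, so the two void probabilities have the same
  -- exponent.
  have hν : ν.real (truncExceed δ F) = c * (ρ.map (truncPoint δ)).real (cylinderBelow F)ᶜ := by
    have h := congrArg (fun μ => μ (truncExceed δ F)) hρ
    simp only [Measure.restrict_apply hW, Measure.smul_apply, smul_eq_mul] at h
    rw [inter_eq_left.2 (truncExceed_subset hδ hF)] at h
    rw [measureReal_def, h, map_measureReal_apply (continuous_truncPoint hδ).measurable hV.compl]
    simp [measureReal_def, truncExceed]
  rw [Measure.map_apply hm hV, Measure.map_apply hm2 hV, hpre, hN.pointSup_preimage hδ hF,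
    hN.measure_eq_zero hW ((isBounded_invRadius_le _).subset (truncExceed_subset hδ hF)), hν,
    ← poissonSample_forall_mem c _ hV, ofReal_measureReal]

end PoissonMaximum

/-! ### Convergence of truncated maxima and the truncation error. -/

section Convergence

variable {T : Type*} [MetricSpace T] [CompactSpace T]

/-- The linear cut-off equal to `1` below `a` and to `0` above `a + b`. -/
noncomputable def cutoff (a b u : ℝ) : ℝ := min 1 (max 0 ((a + b - u) / b))

lemma continuous_cutoff (a b : ℝ) : Continuous (cutoff a b) := by
  unfold cutoff; fun_prop

lemma cutoff_nonneg (a b u : ℝ) : 0 ≤ cutoff a b u := le_min zero_le_one (le_max_left _ _)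

lemma cutoff_le_one (a b u : ℝ) : cutoff a b u ≤ 1 := min_le_left _ _

lemma cutoff_eq_one {a b u : ℝ} (hb : 0 < b) (hu : u ≤ a) : cutoff a b u = 1 :=
  min_eq_left (le_max_of_le_right ((one_le_div hb).2 (by linarith)))

lemma cutoff_eq_zero {a b u : ℝ} (hb : 0 < b) (hu : a + b ≤ u) : cutoff a b u = 0 := by
  rw [cutoff, max_eq_left (div_nonpos_of_nonpos_of_nonneg (by linarith) hb.le)]
  exact min_eq_right zero_le_one

/-- The cut-off of the inverse radius, on `(0, ∞] × S`. -/
noncomputable def cutoffBCF (a b : ℝ) : CBarZeroPlus T →ᵇ ℝ :=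
  radialBCF (cutoff a b) (continuous_cutoff a b) (cutoff_nonneg a b) (cutoff_le_one a b)

lemma cutoffBCF_apply (a b : ℝ) (p : CBarZeroPlus T) : cutoffBCF a b p = cutoff a b (invRadius p) :=
  rfl

lemma isBounded_support_cutoffBCF (a : ℝ) {b : ℝ} (hb : 0 < b) :
    Bornology.IsBounded (Function.support (cutoffBCF (T := T) a b)) :=
  (isBounded_invRadius_le (a + b)).subset fun p hp => by
    by_contra hlt
    exact hp (cutoff_eq_zero hb (not_le.1 hlt).le)

open scoped Classical in
/-- The cut-off of the inverse norm, on the cone of nonnegative functions. -/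
noncomputable def cutoffFun (a b : ℝ) (y : NonnegCont T) : ℝ :=
  -- Without this case the convention `‖0‖⁻¹ = 0` would make the zero function look like one of
  -- infinite norm.
  if y = ⊥ then 0 else cutoff a b ‖y.1‖⁻¹

lemma measurable_cutoffFun (a b : ℝ) : Measurable (cutoffFun (T := T) a b) :=
  Measurable.ite (measurableSet_singleton _) measurable_const
    ((continuous_cutoff a b).measurable.comp measurable_subtype_coe.norm.inv)

lemma cutoffFun_nonneg (a b : ℝ) (y : NonnegCont T) : 0 ≤ cutoffFun a b y := by
  unfold cutoffFun; split_ifs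
  exacts [le_rfl, cutoff_nonneg _ _ _]

lemma cutoffFun_le_one (a b : ℝ) (y : NonnegCont T) : cutoffFun a b y ≤ 1 := by
  unfold cutoffFun; split_ifs
  exacts [zero_le_one, cutoff_le_one _ _ _]

variable {Ω : Type*} [MeasurableSpace Ω] {P : Measure Ω} {X : Ω → NonnegCont T}

lemma integral_cutoffBCF (hX : AEMeasurable (fun ω => (X ω).1) P) (a b : ℝ) (n : ℕ) :
    ∫ p, cutoffBCF a b p ∂((n : ℝ≥0∞) • polarLaw (fun ω => (X ω).1) P) =
      n * ∫ ω, cutoffFun a b (X ω) ∂P := by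
  refine integral_smul_polarLaw hX (cutoffBCF a b).continuous.measurable (measurable_cutoffFun a b)
    (fun x => ?_) (if_pos rfl) n
  rw [cutoffBCF_apply, invRadius_polar, cutoffFun, if_neg]
  exact fun h => x.2.2 (congrArg Subtype.val h)

lemma aemeasurable_truncFun (hX : AEMeasurable X P) {δ : ℝ} (hδ : 0 < δ) :
    AEMeasurable (fun ω => truncFun δ (X ω)) P :=
  (measurable_truncFun hδ).comp_aemeasurable hX

/-- The increment `h (truncPoint δ p) - h ⊥`. -/
noncomputable def truncIncrement {δ : ℝ} (hδ : 0 < δ) (h : NonnegCont T →ᵇ ℝ) :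
    CBarZeroPlus T →ᵇ ℝ :=
  (h.compContinuous ⟨truncPoint δ, continuous_truncPoint hδ⟩) - BoundedContinuousFunction.const _ (h ⊥)

lemma truncIncrement_apply {δ : ℝ} (hδ : 0 < δ) (h : NonnegCont T →ᵇ ℝ) (p : CBarZeroPlus T) :
    truncIncrement hδ h p = h (truncPoint δ p) - h ⊥ := rfl

/-- Bounded support is what makes these increments admissible in `♯`-weak convergence. -/
lemma support_truncIncrement_subset {δ : ℝ} (hδ : 0 < δ) (h : NonnegCont T →ᵇ ℝ) :
    Function.support (truncIncrement hδ h) ⊆ {p | invRadius p ≤ δ⁻¹} := fun p hp => by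
  by_contra hlt
  refine hp ?_
  rw [truncIncrement_apply, truncPoint_eq_bot hδ (not_le.1 hlt).le, sub_self]

lemma integral_truncIncrement (hX : AEMeasurable (fun ω => (X ω).1) P) {δ : ℝ} (hδ : 0 < δ)
    (h : NonnegCont T →ᵇ ℝ) (n : ℕ) :
    ∫ p, truncIncrement hδ h p ∂((n : ℝ≥0∞) • polarLaw (fun ω => (X ω).1) P) =
      n * ∫ ω, (h (truncFun δ (X ω)) - h ⊥) ∂P := by
  refine integral_smul_polarLaw hX (truncIncrement hδ h).continuous.measurable
    (G := fun y => h (truncFun δ y) - h ⊥)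
    ((h.continuous.measurable.comp (measurable_truncFun hδ)).sub_const _) (fun x => ?_) ?_ n
  · rw [truncIncrement_apply, truncPoint_polar]
  · simp only [truncFun_bot, sub_self]

variable {Ω₀ : ℕ → Type*} [∀ n, MeasurableSpace (Ω₀ n)] {P₀ : ∀ n, Measure (Ω₀ n)}
  [∀ n, IsProbabilityMeasure (P₀ n)] {X₀ : ∀ n, Ω₀ n → NonnegCont T}
  {Ω : ℕ → Type*} [∀ n, MeasurableSpace (Ω n)] {P : ∀ n, Measure (Ω n)}
  [∀ n, IsProbabilityMeasure (P n)] {X : ∀ n, ℕ → Ω n → NonnegCont T}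
  {ν : Measure (CBarZeroPlus T)}
  {Ω' : Type*} [MeasurableSpace Ω'] {P' : Measure Ω'} [IsProbabilityMeasure P'] {I : Ω' → Set ℕ}
  {Y : ∀ ω, I ω → CZeroPlus T}

/-- Convergence of the maxima of truncated functions. -/
lemma tendsto_integral_truncFun [Nonempty (CBarZeroPlus T)]
    (hX₀ : ∀ n, AEMeasurable (X₀ n) (P₀ n)) (hX : ∀ n i, AEMeasurable (X n i) (P n))
    (hcopy : ∀ n i, (P n).map (X n i) = (P₀ n).map (X₀ n)) (hindep : ∀ n, iIndepFun (X n) (P n))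
    (hν : SharpTendsto (fun n : ℕ => (n : ℝ≥0∞) • polarLaw (fun ω => (X₀ n ω).1) (P₀ n)) ν)
    (hN : IsPoissonPointProcess (fun ω => pointMeasure fun i => polar (Y ω i)) ν P')
    {δ : ℝ} (hδ : 0 < δ) (f : NonnegCont T →ᵇ ℝ) {L : ℝ} (hL : 0 ≤ L)
    (hf : ∀ x y, |f x - f y| ≤ L * dist x y) :
    Tendsto (fun n => ∫ ω, f ((Finset.range n).sup fun i => truncFun δ (X n i ω)) ∂P n) atTop
      (𝓝 (∫ ω, f (pointSup δ (Y ω) (hN.finite_setOf_invRadius_le ω δ⁻¹)) ∂P')) := by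
  have hτ := measurable_truncFun (T := T) hδ
  have hσ := (continuous_truncPoint (T := T) hδ).measurable
  have hX₀' : ∀ n, AEMeasurable (fun ω => (X₀ n ω).1) (P₀ n) := fun n =>
    measurable_subtype_coe.comp_aemeasurable (hX₀ n)
  let Q : ℕ → Measure (NonnegCont T) := fun n => (P₀ n).map fun ω => truncFun δ (X₀ n ω)
  have hQ : ∀ n, IsProbabilityMeasure (Q n) := fun n =>
    Measure.isProbabilityMeasure_map (aemeasurable_truncFun (hX₀ n) hδ)
  have hB := measurableSet_invRadius_le (T := T) δ⁻¹
  have : IsFiniteMeasure (ν.restrict {p | invRadius p ≤ δ⁻¹}) := isFiniteMeasure_restrict.2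
    (hν.boundedlyFinite_lim _ hB (isBounded_invRadius_le _)).ne
  obtain ⟨ρ, hρp, hρ⟩ := exists_isProbabilityMeasure_smul_eq (ν.restrict {p | invRadius p ≤ δ⁻¹})
  set c : ℝ≥0 := (ν.restrict {p | invRadius p ≤ δ⁻¹} univ).toNNReal with hc
  rw [← ENNReal.coe_toNNReal (measure_ne_top (ν.restrict {p | invRadius p ≤ δ⁻¹}) univ), ← hc] at hρ
  have hρσ : IsProbabilityMeasure (ρ.map (truncPoint δ)) :=
    Measure.isProbabilityMeasure_map hσ.aemeasurable
  have hlim : ∫ ω, f (pointSup δ (Y ω) (hN.finite_setOf_invRadius_le ω δ⁻¹)) ∂P' =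
      ∑' k : ℕ, Real.exp (-c) * (c : ℝ) ^ k / k.factorial *
        (supAverage (ρ.map (truncPoint δ)) ^ k) f ⊥ := by
    rw [← integral_sup_poissonSample]
    have h1 := integral_map (hN.measurable_pointSup hδ).aemeasurable
      f.continuous.aestronglyMeasurable (μ := P')
    rw [← h1, hN.map_pointSup hδ hρ]
    exact integral_map (measurable_from_prod_countable_right fun k =>
      measurable_sup_range k).aemeasurable f.continuous.aestronglyMeasurable
  have hiid : ∀ n, ∫ ω, f ((Finset.range n).sup fun i => truncFun δ (X n i ω)) ∂P n =
      (supAverage (Q n) ^ n) f ⊥ := fun n => by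
    refine integral_sup_range_eq (fun i => aemeasurable_truncFun (hX n i) hδ)
      ((hindep n).comp (fun _ => truncFun δ) fun _ => hτ) (fun i => ?_) f n
    have h1 := AEMeasurable.map_map_of_aemeasurable hτ.aemeasurable (hX n i)
    have h2 := AEMeasurable.map_map_of_aemeasurable hτ.aemeasurable (hX₀ n)
    rw [hcopy n i, h2] at h1
    exact h1.symm
  -- A function with nonzero truncation has inverse norm at most `δ⁻¹`, where the cut-off is `1`;
  -- the cut-off integrals converge, hence are bounded.
  obtain ⟨C, hC⟩ : ∃ C, ∀ n : ℕ, n * (Q n).real {y | y ≠ ⊥} ≤ C := by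
    obtain ⟨C, hC⟩ := (hν.tendsto_integral (cutoffBCF δ⁻¹ 1)
      (isBounded_support_cutoffBCF _ one_pos)).bddAbove_range
    refine ⟨C, fun n => ?_⟩
    have hCn := hC ⟨n, rfl⟩
    dsimp only at hCn
    rw [integral_cutoffBCF (hX₀' n)] at hCn
    refine le_trans ?_ hCn
    have hm : MeasurableSet {y : NonnegCont T | y ≠ ⊥} := (measurableSet_singleton _).compl
    gcongr
    rw [← integral_indicator_one hm,
      integral_map (aemeasurable_truncFun (hX₀ n) hδ)
        (measurable_one.indicator hm).aestronglyMeasurable]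
    refine integral_mono ?_ ?_ fun ω => ?_
    · refine Integrable.of_bound (((measurable_one.indicator hm).comp_aemeasurable
        (aemeasurable_truncFun (hX₀ n) hδ)).aestronglyMeasurable) 1 (ae_of_all _ fun ω => ?_)
      by_cases h : truncFun δ (X₀ n ω) ≠ ⊥ <;> simp [h]
    · refine Integrable.of_bound (((measurable_cutoffFun _ _).comp_aemeasurable
        (hX₀ n)).aestronglyMeasurable) 1 (ae_of_all _ fun ω => ?_)
      rw [Real.norm_of_nonneg (cutoffFun_nonneg _ _ _)]
      exact cutoffFun_le_one _ _ _
    · by_cases h : truncFun δ (X₀ n ω) ≠ ⊥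
      · have h0 : X₀ n ω ≠ ⊥ := fun h0 => h (by rw [h0, truncFun_bot])
        have h1 : ‖(X₀ n ω).1‖⁻¹ ≤ δ⁻¹ := by
          by_contra hlt
          refine h (Subtype.ext ?_)
          change truncRadius δ ‖(X₀ n ω).1‖⁻¹ • ‖(X₀ n ω).1‖⁻¹ • (X₀ n ω).1 = 0
          rw [truncRadius_eq_zero hδ (not_le.1 hlt).le, zero_smul]
        dsimp only
        rw [indicator_of_mem (by exact h), cutoffFun, if_neg h0, cutoff_eq_one one_pos h1]
        exact le_rfl
      · dsimp only
        rw [indicator_of_notMem (by exact h)]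
        exact cutoffFun_nonneg _ _ _
  rw [hlim]
  simp_rw [hiid]
  refine tendsto_supAverage_pow (fun x y z => ?_) hC (fun h => ?_) f hL hf ⊥
  · exact (dist_sup_sup_le_max_nonneg x y z z).trans (by simp)
  · have hhc : Continuous fun y => h y - h ⊥ := h.continuous.sub continuous_const
    have h1 : ∀ n : ℕ, (n : ℝ) * ∫ y, (h y - h ⊥) ∂Q n =
        ∫ p, truncIncrement hδ h p ∂((n : ℝ≥0∞) • polarLaw (fun ω => (X₀ n ω).1) (P₀ n)) := by
      intro n
      rw [integral_truncIncrement (hX₀' n), integral_map (aemeasurable_truncFun (hX₀ n) hδ)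
        hhc.aestronglyMeasurable]
    have h2 : (c : ℝ) * ∫ y, (h y - h ⊥) ∂(ρ.map (truncPoint δ)) = ∫ p, truncIncrement hδ h p ∂ν := by
      rw [← setIntegral_eq_integral_of_forall_compl_eq_zero (s := {p | invRadius p ≤ δ⁻¹})
        (fun p hp => by_contra fun h0 => hp (support_truncIncrement_subset hδ h h0)), hρ,
        integral_smul_measure, integral_map hσ.aemeasurable
        hhc.aestronglyMeasurable]
      rfl
    simp_rw [h1, h2]
    exact hν.tendsto_integral _ ((isBounded_invRadius_le _).subset
      (support_truncIncrement_subset hδ h))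

/-- A point of finite radius leaves the support once `2 δ` is below its inverse radius; for `δ ≤ 1`
everything is dominated by the indicator of a set of finite mass. -/
lemma tendsto_integral_cutoffBCF_zero (hν : IsBoundedlyFinite ν) (hν_top : ν {p | p.radius = ∞} = 0) :
    Tendsto (fun δ => ∫ p, cutoffBCF δ δ p ∂ν) (𝓝[>] 0) (𝓝 0) := by
  have hfin : ν {p : CBarZeroPlus T | invRadius p ≤ 2} < ∞ :=
    hν _ (measurableSet_invRadius_le _) (isBounded_invRadius_le _)
  have h : Tendsto (fun δ => ∫ p, cutoffBCF δ δ p ∂ν) (𝓝[>] 0)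
      (𝓝 (∫ p : CBarZeroPlus T, (0 : ℝ) ∂ν)) := by
    refine tendsto_integral_filter_of_dominated_convergence
      ({p : CBarZeroPlus T | invRadius p ≤ 2}.indicator fun _ => (1 : ℝ))
      (.of_forall fun δ => (cutoffBCF δ δ).continuous.aestronglyMeasurable) ?_
      ((integrable_indicator_iff (measurableSet_invRadius_le _)).2 (integrableOn_const hfin.ne)) ?_
    · filter_upwards [Ioc_mem_nhdsGT one_pos] with δ hδ
      refine ae_of_all _ fun p => ?_
      rw [cutoffBCF_apply, Real.norm_of_nonneg (cutoff_nonneg _ _ _)]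
      by_cases hp : invRadius p ≤ 2
      · rw [indicator_of_mem (by exact hp)]
        exact cutoff_le_one _ _ _
      · rw [indicator_of_notMem (by exact hp)]
        exact (cutoff_eq_zero hδ.1 (by linarith [hδ.2])).le
    · have : ∀ᵐ p ∂ν, p.radius ≠ ∞ := by
        rw [ae_iff]
        simpa using hν_top
      filter_upwards [this] with p hp
      have hpos : 0 < invRadius p := by
        refine ENNReal.toReal_pos (ENNReal.inv_ne_zero.2 hp) (ENNReal.inv_ne_top.2 p.radius_pos.ne')
      refine tendsto_const_nhds.congr' ?_
      filter_upwards [Ioc_mem_nhdsGT (show 0 < invRadius p / 2 by positivity)] with δ hδ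
      exact (cutoff_eq_zero hδ.1 (by linarith [hδ.2])).symm
  simpa using h

/-- The error made by truncating functions. -/
lemma abs_integral_sub_truncFun_le {Ω : Type*} [MeasurableSpace Ω] {P : Measure Ω}
    [IsProbabilityMeasure P] {Z : ℕ → Ω → NonnegCont T} (hZ : ∀ i, AEMeasurable (Z i) P)
    {Q : Measure (NonnegCont T)} (hQ : ∀ i, P.map (Z i) = Q) (f : NonnegCont T →ᵇ ℝ) {L : ℝ}
    (hL : 0 ≤ L) (hf : ∀ x y, |f x - f y| ≤ L * dist x y) {δ : ℝ} (hδ : 0 < δ) (n : ℕ) :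
    |∫ ω, f ((Finset.range n).sup fun i => Z i ω) ∂P -
        ∫ ω, f ((Finset.range n).sup fun i => truncFun δ (Z i ω)) ∂P| ≤
      L * δ + 2 * ‖f‖ * (n * ∫ y, cutoffFun δ δ y ∂Q) := by
  have hsup : ∀ Z : ℕ → Ω → NonnegCont T, (∀ i, AEMeasurable (Z i) P) →
      Integrable (fun ω => f ((Finset.range n).sup fun i => Z i ω)) P := fun Z hZ => by
    have hm : AEMeasurable (fun ω => (Finset.range n).sup fun i => Z i ω) P :=
      (measurable_sup_range n).comp_aemeasurable (aemeasurable_pi_lambda _ hZ)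
    exact Integrable.of_bound (f.continuous.measurable.comp_aemeasurable hm).aestronglyMeasurable ‖f‖
      (ae_of_all _ fun ω => f.norm_coe_le_norm _)
  have hcut : ∀ i, Integrable (fun ω => cutoffFun δ δ (Z i ω)) P := fun i =>
    Integrable.of_bound ((measurable_cutoffFun δ δ).comp_aemeasurable (hZ i)).aestronglyMeasurable 1
      (ae_of_all _ fun ω => by
        rw [Real.norm_of_nonneg (cutoffFun_nonneg _ _ _)]; exact cutoffFun_le_one _ _ _)
  have hpt : ∀ ω, |f ((Finset.range n).sup fun i => Z i ω) -
      f ((Finset.range n).sup fun i => truncFun δ (Z i ω))| ≤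
        L * δ + 2 * ‖f‖ * ∑ i ∈ Finset.range n, cutoffFun δ δ (Z i ω) := by
    intro ω
    have hs : 0 ≤ ∑ i ∈ Finset.range n, cutoffFun δ δ (Z i ω) :=
      Finset.sum_nonneg fun _ _ => cutoffFun_nonneg _ _ _
    -- Either all norms are at most `1 / δ` and the maxima differ by at most `δ`, or some cut-off
    -- equals `1` and pays for the trivial bound `2 ‖f‖`.
    by_cases h : ∀ i ∈ Finset.range n, ‖(Z i ω).1‖ ≤ δ⁻¹
    · have h1 := dist_finset_sup_le (Finset.range n) (fun i => Z i ω) (fun i => truncFun δ (Z i ω))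
        hδ.le fun i hi => by rw [dist_comm]; exact dist_truncFun_le hδ (h i hi)
      refine (hf _ _).trans ?_
      have := mul_le_mul_of_nonneg_left h1 hL
      have : 0 ≤ 2 * ‖f‖ * ∑ i ∈ Finset.range n, cutoffFun δ δ (Z i ω) := by positivity
      linarith
    · push Not at h
      obtain ⟨i, hi, hiδ⟩ := h
      have hpos : 0 < ‖(Z i ω).1‖ := (inv_pos.2 hδ).trans hiδ
      have h1 : cutoffFun δ δ (Z i ω) = 1 := by
        rw [cutoffFun, if_neg, cutoff_eq_one hδ]
        · exact inv_le_of_inv_le₀ hδ hiδ.le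
        · intro h0
          rw [h0] at hpos
          exact hpos.ne' norm_zero
      have h2 : 1 ≤ ∑ i ∈ Finset.range n, cutoffFun δ δ (Z i ω) := h1 ▸
        Finset.single_le_sum (f := fun i => cutoffFun δ δ (Z i ω))
          (fun _ _ => cutoffFun_nonneg _ _ _) hi
      have h3 : |f ((Finset.range n).sup fun i => Z i ω) -
          f ((Finset.range n).sup fun i => truncFun δ (Z i ω))| ≤ 2 * ‖f‖ := by
        rw [← Real.dist_eq]; exact f.dist_le_two_norm _ _
      have h4 : 2 * ‖f‖ * 1 ≤ 2 * ‖f‖ * ∑ i ∈ Finset.range n, cutoffFun δ δ (Z i ω) := by gcongr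
      have : 0 ≤ L * δ := by positivity
      linarith
  rw [← integral_sub (hsup Z hZ) (hsup _ fun i => aemeasurable_truncFun (hZ i) hδ)]
  refine (norm_integral_le_of_norm_le (f := fun ω => f ((Finset.range n).sup fun i => Z i ω) -
      f ((Finset.range n).sup fun i => truncFun δ (Z i ω)))
    ((integrable_const (L * δ)).add ((integrable_finsetSum (Finset.range n)
      fun i _ => hcut i).const_mul (2 * ‖f‖))) (ae_of_all _ hpt)).trans_eq ?_
  simp only [Pi.add_apply]
  rw [integral_add (integrable_const _) ((integrable_finsetSum _ fun i _ => hcut i).const_mul _),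
    integral_const_mul (2 * ‖f‖), integral_finsetSum _ fun i _ => hcut i]
  have : ∀ i, ∫ ω, cutoffFun δ δ (Z i ω) ∂P = ∫ y, cutoffFun δ δ y ∂Q := fun i => by
    rw [← hQ i, integral_map (hZ i) (measurable_cutoffFun δ δ).aestronglyMeasurable]
  simp [this]

end Convergence

/-! ### Removal of the truncation and the main theorem. -/

section Main

variable {T : Type*} [MetricSpace T] [CompactSpace T]
  {Ω₀ : ℕ → Type*} [∀ n, MeasurableSpace (Ω₀ n)] {P₀ : ∀ n, Measure (Ω₀ n)}
  [∀ n, IsProbabilityMeasure (P₀ n)] {X₀ : ∀ n, Ω₀ n → NonnegCont T}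
  {Ω : ℕ → Type*} [∀ n, MeasurableSpace (Ω n)] {P : ∀ n, Measure (Ω n)}
  [∀ n, IsProbabilityMeasure (P n)] {X : ∀ n, ℕ → Ω n → NonnegCont T}
  {ν : Measure (CBarZeroPlus T)}
  {Ω' : Type*} [MeasurableSpace Ω'] {P' : Measure Ω'} [IsProbabilityMeasure P'] {I : Ω' → Set ℕ}
  {Y : ∀ ω, I ω → CZeroPlus T}

lemma poissonMeasure_zero_eq : poissonMeasure 0 = Measure.dirac 0 := by
  refine Measure.ext_of_singleton fun n => ?_
  rw [poissonMeasure_singleton]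
  cases n <;> simp

lemma iIndepFun_const_apply {Ω ι E : Type*} [MeasurableSpace Ω] [MeasurableSpace E] (P : Measure Ω)
    [IsProbabilityMeasure P] (c : ι → E) : iIndepFun (fun i (_ : Ω) => c i) P := by
  rw [iIndepFun_iff_map_fun_eq_infinitePi_map (by fun_prop)]
  simp [Measure.map_const]

/-- The positive part, as an element of the cone. -/
noncomputable def toNonneg (x : C(T, ℝ)) : NonnegCont T := ⟨x ⊔ 0, Set.mem_Ici.2 le_sup_right⟩

lemma measurable_toNonneg : Measurable (toNonneg (T := T)) :=
  (continuous_id.sup continuous_const).measurable.subtype_mk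

lemma toNonneg_of_nonneg {x : C(T, ℝ)} (hx : 0 ≤ x) : toNonneg x = ⟨x, hx⟩ :=
  Subtype.ext (sup_eq_left.2 hx)

lemma nonempty_cBarZeroPlus [Nonempty T] : Nonempty (CBarZeroPlus T) :=
  ⟨⟨1, 1, one_pos, zero_le_one, norm_one⟩⟩

lemma measurable_of_tendsto_pointSup
    (hN : IsPoissonPointProcess (fun ω => pointMeasure fun i => polar (Y ω i)) ν P')
    {M : Ω' → NonnegCont T}
    (hM : ∀ ω, Tendsto (fun δ => pointSup δ (Y ω) (hN.finite_setOf_invRadius_le ω δ⁻¹))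
      (𝓝[>] 0) (𝓝 (M ω))) : Measurable M := by
  obtain ⟨u, -, hu0, hu⟩ := exists_seq_strictAnti_tendsto (0 : ℝ)
  refine measurable_of_tendsto_metrizable (fun k => hN.measurable_pointSup (hu0 k))
    (tendsto_pi_nhds.2 fun ω => (hM ω).comp ?_)
  exact tendsto_nhdsWithin_iff.2 ⟨hu, .of_forall hu0⟩

lemma tendsto_integral_sup [Nonempty (CBarZeroPlus T)]
    (hX₀ : ∀ n, AEMeasurable (X₀ n) (P₀ n)) (hX : ∀ n i, AEMeasurable (X n i) (P n))
    (hcopy : ∀ n i, (P n).map (X n i) = (P₀ n).map (X₀ n)) (hindep : ∀ n, iIndepFun (X n) (P n))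
    (hν : SharpTendsto (fun n : ℕ => (n : ℝ≥0∞) • polarLaw (fun ω => (X₀ n ω).1) (P₀ n)) ν)
    (hν_top : ν {p | p.radius = ∞} = 0)
    (hN : IsPoissonPointProcess (fun ω => pointMeasure fun i => polar (Y ω i)) ν P')
    {M : Ω' → NonnegCont T}
    (hM : ∀ ω, Tendsto (fun δ => pointSup δ (Y ω) (hN.finite_setOf_invRadius_le ω δ⁻¹))
      (𝓝[>] 0) (𝓝 (M ω)))
    (f : NonnegCont T →ᵇ ℝ) {L : ℝ} (hL : 0 ≤ L) (hf : ∀ x y, |f x - f y| ≤ L * dist x y) :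
    Tendsto (fun n => ∫ ω, f ((Finset.range n).sup fun i => X n i ω) ∂P n) atTop
      (𝓝 (∫ ω, f (M ω) ∂P')) := by
  have hMlim : Tendsto (fun δ => ∫ ω, f (pointSup δ (Y ω) (hN.finite_setOf_invRadius_le ω δ⁻¹)) ∂P')
      (𝓝[>] 0) (𝓝 (∫ ω, f (M ω) ∂P')) := by
    refine tendsto_integral_filter_of_dominated_convergence (fun _ => ‖f‖) ?_
      (.of_forall fun δ => ae_of_all _ fun ω => f.norm_coe_le_norm _) (integrable_const _)
      (ae_of_all _ fun ω => (f.continuous.tendsto _).comp (hM ω))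
    filter_upwards [self_mem_nhdsWithin] with δ hδ
    exact (f.continuous.measurable.comp (hN.measurable_pointSup hδ)).aestronglyMeasurable
  have herr : Tendsto (fun δ : ℝ => L * δ + 2 * ‖f‖ * ∫ p, cutoffBCF δ δ p ∂ν) (𝓝[>] 0) (𝓝 0) := by
    have h1 : Tendsto (fun δ : ℝ => L * δ) (𝓝[>] 0) (𝓝 (L * 0)) :=
      (tendsto_id.mono_left nhdsWithin_le_nhds).const_mul L
    simpa using h1.add
      ((tendsto_integral_cutoffBCF_zero hν.boundedlyFinite_lim hν_top).const_mul (2 * ‖f‖))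
  rw [Metric.tendsto_nhds]
  intro ε hε
  -- `δ` is chosen before `n`: the limiting error bound and the distance from the truncated Poisson
  -- maximum to `M` are each below `ε / 3`; the last third comes from `n → ∞` at this fixed `δ`.
  obtain ⟨δ, hδ, h1, h2⟩ := ((eventually_mem_nhdsWithin (a := (0 : ℝ)) (s := Ioi 0)).and
    ((herr.eventually (gt_mem_nhds (show (0 : ℝ) < ε / 3 by positivity))).and
      (Metric.tendsto_nhds.1 hMlim (ε / 3) (by positivity)))).exists
  rw [mem_Ioi] at hδ
  have hcut := (hν.tendsto_integral (cutoffBCF δ δ)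
    (isBounded_support_cutoffBCF _ hδ)).const_mul (2 * ‖f‖) |>.const_add (L * δ)
  have htr := tendsto_integral_truncFun hX₀ hX hcopy hindep hν hN hδ f hL hf
  filter_upwards [hcut.eventually (gt_mem_nhds h1), Metric.tendsto_nhds.1 htr (ε / 3) (by positivity)]
    with n h3 h4
  have h5 := abs_integral_sub_truncFun_le (hX n) (hcopy n) f hL hf hδ n
  rw [integral_map (hX₀ n) (measurable_cutoffFun δ δ).aestronglyMeasurable,
    ← integral_cutoffBCF (measurable_subtype_coe.comp_aemeasurable (hX₀ n))] at h5
  rw [Real.dist_eq] at *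
  rw [abs_lt] at *
  rw [abs_le] at h5
  constructor <;> linarith

end Main

/-- Row `n` of the array consists of independent copies `X n 0, X n 1, …` of the nonnegative
continuous process `X₀ n`. -/
theorem theorem1 {T : Type u} [MetricSpace T] [CompactSpace T]
    {Ω₀ : ℕ → Type w₀} [∀ n, MeasurableSpace (Ω₀ n)]
    (P₀ : ∀ n, Measure (Ω₀ n)) [∀ n, IsProbabilityMeasure (P₀ n)]
    (X₀ : ∀ n, Ω₀ n → C(T, ℝ)) (hX₀ : ∀ n ω, 0 ≤ X₀ n ω)
    {Ω : ℕ → Type w} [∀ n, MeasurableSpace (Ω n)]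
    (P : ∀ n, Measure (Ω n)) [∀ n, IsProbabilityMeasure (P n)]
    (X : ∀ n, ℕ → Ω n → C(T, ℝ)) (hX : ∀ n i ω, 0 ≤ X n i ω)
    (hcopy : ∀ n i, IdentDistrib (X n i) (X₀ n) (P n) (P₀ n))
    (hindep : ∀ n, iIndepFun (X n) (P n))
    (ν : Measure (CBarZeroPlus T))
    (hν : SharpTendsto (fun n : ℕ => (n : ℝ≥0∞) • polarLaw (X₀ n) (P₀ n)) ν)
    (hν_top : ν {p | p.radius = ∞} = 0) :
    -- Poisson point processes on `C₀⁺` with intensity `ν` exist,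
    (∃ (Ω' : Type u) (_ : MeasurableSpace Ω') (P' : Measure Ω') (_ : IsProbabilityMeasure P')
      (I : Ω' → Set ℕ) (Y : ∀ ω, I ω → CZeroPlus T),
      IsPoissonPointProcess (fun ω => pointMeasure fun i => polar (Y ω i)) ν P') ∧
    -- and for each of them the pointwise supremum `M` of its points is a random element of `C(T)`,
    -- to which the maxima converge weakly.
    (∀ (Ω' : Type v) [MeasurableSpace Ω'] (P' : Measure Ω') [IsProbabilityMeasure P']
      (I : Ω' → Set ℕ) (Y : ∀ ω, I ω → CZeroPlus T),
      IsPoissonPointProcess (fun ω => pointMeasure fun i => polar (Y ω i)) ν P' →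
      ∃ M : Ω' → C(T, ℝ),
        (∀ ω t, IsLUB (insert 0 (range fun i => (Y ω i).1 t)) (M ω t)) ∧
        TendstoInDistribution (fun n ω => maxFun (fun i => X n i ω) n) atTop M P P') := by
  refine ⟨?_, fun Ω' _ P' _ I Y hN => ?_⟩
  · rcases isEmpty_or_nonempty (CBarZeroPlus T) with hE | hE
    -- On an empty space of points, as when `T` is empty, every measure is zero and the empty
    -- process works.
    · refine ⟨PUnit, inferInstance, Measure.dirac PUnit.unit, inferInstance, fun _ => ∅,
        fun _ i => i.2.elim, measurable_const, fun _ => ⟨∅, fun i => i.2.elim, fun B _ => toFinite _,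
          Subsingleton.elim _ _⟩, fun B _ _ => ?_, fun m B _ _ _ => ?_⟩
      all_goals
        have h0 : ∀ (μ : Measure (CBarZeroPlus T)) B, μ B = 0 := fun μ B => by
          rw [Subsingleton.elim μ 0]; rfl
        simp only [h0]
      · rw [Measure.map_const, measure_univ, one_smul, ENNReal.toNNReal_zero, poissonMeasure_zero_eq]
        exact ((Measure.map_dirac' (f := fun k : ℕ => (k : ℝ≥0∞)) .of_discrete 0).trans (by simp)).symm
      · exact iIndepFun_const_apply _ _
    · have hG : MeasurableSet {p : CBarZeroPlus T | p.radius = ∞}ᶜ := by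
        have : {p : CBarZeroPlus T | p.radius = ∞} = {p | invRadius p ≤ 0} := by
          ext p
          simp only [mem_ofPred_eq]
          rw [(invRadius_nonneg p).ge_iff_eq', invRadius, ENNReal.toReal_eq_zero_iff]
          simp [p.radius_pos.ne']
        rw [this]
        exact (measurableSet_invRadius_le 0).compl
      obtain ⟨Ω', mΩ', P', hP', I, x, hx, hN⟩ :=
        exists_isPoissonPointProcess hν.boundedlyFinite_lim hG (by rwa [compl_compl])
      choose Y hY using fun ω i => exists_polar_eq (hx ω i)
      refine ⟨Ω', mΩ', P', hP', I, Y, ?_⟩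
      simp_rw [hY]
      exact hN
  · choose M hM hMδ using fun ω => exists_isLUB_continuousMap (Y ω)
      (hN.finite_setOf_invRadius_le ω)
    have hM0 : ∀ ω, 0 ≤ M ω := fun ω t => (hM ω t).1 (mem_insert _ _)
    let X' : ∀ n, ℕ → Ω n → NonnegCont T := fun n i ω => ⟨X n i ω, hX n i ω⟩
    let X₀' : ∀ n, Ω₀ n → NonnegCont T := fun n ω => ⟨X₀ n ω, hX₀ n ω⟩
    let M' : Ω' → NonnegCont T := fun ω => ⟨M ω, hM0 ω⟩
    have hM' : ∀ ω, Tendsto (fun δ => pointSup δ (Y ω) (hN.finite_setOf_invRadius_le ω δ⁻¹))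
        (𝓝[>] 0) (𝓝 (M' ω)) := fun ω => by
      refine tendsto_iff_dist_tendsto_zero.2 (squeeze_zero' (.of_forall fun _ => dist_nonneg) (hMδ ω)
        (tendsto_id.mono_left nhdsWithin_le_nhds))
    have hMm : Measurable M :=
      measurable_subtype_coe.comp (measurable_of_tendsto_pointSup hN hM')
    have hX'm : ∀ n i, AEMeasurable (X' n i) (P n) := fun n i =>
      (hcopy n i).aemeasurable_fst.subtype_mk
    have hX₀'m : ∀ n, AEMeasurable (X₀' n) (P₀ n) := fun n =>
      (hcopy n 0).aemeasurable_snd.subtype_mk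
    have hsupm : ∀ n, AEMeasurable (fun ω => (Finset.range n).sup fun i => X' n i ω) (P n) := fun n =>
      (measurable_sup_range n).comp_aemeasurable (aemeasurable_pi_lambda _ (hX'm n))
    have hmaxm : ∀ n, AEMeasurable (fun ω => maxFun (fun i => X n i ω) n) (P n) := fun n =>
      (measurable_subtype_coe.comp_aemeasurable (hsupm n)).congr
        (ae_of_all _ fun ω => (maxFun_eq_sup (fun i => X' n i ω) n).symm)
    refine ⟨M, hM, hmaxm, hMm.aemeasurable, ?_⟩
    -- Bounded Lipschitz test functions suffice for weak convergence; the generator bounds rely on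
    -- the Lipschitz constant.
    refine tendsto_iff_forall_lipschitz_integral_tendsto.2 ?_
    rintro f ⟨C, hC⟩ ⟨L, hL⟩
    simp only [ProbabilityMeasure.coe_mk]
    rw [integral_map hMm.aemeasurable hL.continuous.aestronglyMeasurable]
    simp_rw [fun n => integral_map (hmaxm n) hL.continuous.aestronglyMeasurable]
    rcases isEmpty_or_nonempty T with hT | hT
    · have hsub : ∀ x, f x = f 0 := fun x => congrArg f (Subsingleton.elim _ _)
      simp_rw [hsub]
      simp
    · have := nonempty_cBarZeroPlus (T := T)
      let g : NonnegCont T →ᵇ ℝ := ⟨⟨fun y => f y.1, hL.continuous.comp continuous_subtype_val⟩,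
        C, fun x y => hC _ _⟩
      have hcopy' : ∀ n i, (P n).map (X' n i) = (P₀ n).map (X₀' n) := fun n i => by
        -- Equality in law, and below independence, transfer to the cone through a measurable map
        -- defined on all of `C(T)`.
        have h := ((hcopy n i).comp measurable_toNonneg).map_eq
        simpa only [Function.comp_def, toNonneg_of_nonneg (hX n i _),
          toNonneg_of_nonneg (hX₀ n _)] using h
      have hindep' : ∀ n, iIndepFun (X' n) (P n) := fun n => by
        have h := (hindep n).comp (fun _ => toNonneg) fun _ => measurable_toNonneg
        simpa only [Function.comp_def, toNonneg_of_nonneg (hX n _ _)] using h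
      have h := tendsto_integral_sup hX₀'m hX'm hcopy' hindep' hν hν_top hN hM' g L.2
        (fun x y => by rw [← Real.dist_eq]; exact hL.dist_le_mul _ _)
      refine h.congr fun n => integral_congr_ae (ae_of_all _ fun ω => ?_)
      exact congrArg f (maxFun_eq_sup (fun i => X' n i ω) n).symm
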